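/- Let $d\in\{2,3\}$, $T>0$, and let $\hat\Omega\subset\mathbb R^d$ be the union of a finite conforming family of closed $d$-simplices $\hat K$ (the reference mesh). For $t\in[0,T]$ let $\mathcal A_t:\hat\Omega\to\Omega_t:=\mathcal A_t(\hat\Omega)$ be a bijective ALE map, affine on every $\hat K$, with $t\mapsto\mathcal A_t(Y)$ of class $C^1$ on $[0,T]$ for each $Y\in\hat\Omega$. The cells at time $t$ are $K=\mathcal A_t(\hat K)$; they form $\mathcal T_{h,t}$, and $h_K$ is the diameter of $K$. The mesh velocity is $w_h(t,x)=\partial_t\mathcal A_t(Y)$, and $\partial_t u|_Y(t,x)=\frac{d}{dt}\big[u(t,\mathcal A_t(Y))\big]$, both at $Y=\mathcal A_t^{-1}(x)$. For a fixed degree $k$, let $V_h=V_h(t)$ be the space of continuous functions on $\Omega_t$ that vanish on $\partial\Omega_t$ and are polynomials of degree at most $k$ on each cell. Norms $\|\cdot\|_0$, $\|\cdot\|_{0,K}$ and inner products $(\cdot,\cdot)$, $(\cdot,\cdot)_K$ are those of $L^2(\Omega_t)$ and $L^2(K)$. Let $\epsilon>0$; let $b$ be a vector field that is continuous on $\{(t,x):0\le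 t\le T,\ x\in\Omega_t\}$ and Lipschitz in $x$ for each $t\in(0,T]$; let $c(t,\cdot)\in L^\infty(\Omega_t)$ and $f(t,\cdot)\in L^2(\Omega_t)$ for each $t\in(0,T]$, with $\int_0^T\|f\|_0^2\,dt<\infty$; and let $\delta_K=\delta_K(t)\ge 0$ be measurable in $t$. Set $$a_{SUPG}(u,v)=\epsilon(\nabla u,\nabla v)+(b\cdot\nabla u,v)+(cu,v)+\sum_{K\in\mathcal T_{h,t}}\delta_K\big(-\epsilon\Delta u+(b-w_h)\cdot\nabla u+cu,\ (b-w_h)\cdot\nabla v\big)_K .$$ Let $u_h(t,\cdot)\in V_h(t)$, $t\in[0,T]$, solve the semi-discrete ALE-SUPG problem: $t\mapsto u_h(t,\mathcal A_t(Y))$ is continuous on $[0,T]$ and differentiable on $(0,T]$ for each $Y\in\hat\Omega$; $u_h(0)$ is the $L^2$-projection onto $V_h(0)$ of an initial datum $u_0\in L^2(\Omega_0)$; and for all $t\in(0,T]$ and all $v_h\in V_h(t)$ $$\big(\partial_t u_h|_Y,v_h\big)+a_{SUPG}(u_h,v_h)-(w_h\cdot\nabla u_h,v_h)=(f,v_h)+\sum_{K\in\mathcal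 T_{h,t}}\delta_K\big(f,(b-w_h)\cdot\nabla v_h\big)_K .$$ Assume that for some constant $\mu>0$ and every $t\in(0,T]$, $c-\tfrac12\nabla\cdot b\ge\mu$ almost everywhere in $\Omega_t$. Let $c_{inv}>0$ be a constant of the inverse inequality, i.e. $\|\Delta v_h\|_{0,K}\le c_{inv}h_K^{-1}\|\nabla v_h\|_{0,K}$ for all $t\in(0,T]$, $v_h\in V_h(t)$ and $K\in\mathcal T_{h,t}$. Assume that for all $t\in(0,T]$ and $K\in\mathcal T_{h,t}$ $$\delta_K\le\frac{\mu}{2\|c\|_{L^\infty(K)}^2},\qquad \delta_K\le\frac{h_K^2}{2\epsilon c_{inv}^2},$$ where the first condition is void if $c=0$ almost everywhere on $K$. Let $$|||u|||^2=\epsilon\|\nabla u\|_0^2+\sum_{K\in\mathcal T_{h,t}}\delta_K\|(b-w_h)\cdot\nabla u\|_{0,K}^2+\mu\|u\|_0^2 .$$ Then $t\mapsto|||u_h(t)|||^2$ is integrable on $(0,T)$, and for every $\tau\in[0,T]$ (in particular for $\tau=T$) $$\|u_h(\tau)\|_0^2+\frac12\int_0^\tau|||u_h|||^2\,dt\le\|u_h(0)\|_0^2+\frac2\mu\int_0^\tau\|f\|_0^2\,dt+2\int_0^\tau\sum_{K\in\mathcal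 T_{h,t}}\delta_K\|f\|_{0,K}^2\,dt .$$ In particular, the constants in the bound do not depend on the mesh velocity. -/

import Mathlib

open MeasureTheory Set
open scoped NNReal

noncomputable section

namespace ALESUPG

/-- The Euclidean space `ℝᵈ`. -/
abbrev Space (d : ℕ) : Type := EuclideanSpace ℝ (Fin d)

/-- A reference domain triangulated into finitely many `d`-simplices, together with a
semi-discrete (continuous in time) ALE map, which is affine on every reference cell. -/
structure MovingMesh (d : ℕ) (T : ℝ) where
  /-- the conforming simplicial decomposition of the (closed) reference domain -/
  ref : Geometry.SimplicialComplex ℝ (Space d)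
  /-- the reference cells, each given by its `d + 1` vertices -/
  cells : Finset (Finset (Space d))
  mem_cells : ∀ s, s ∈ cells ↔ s ∈ ref.faces ∧ s.card = d + 1
  /-- every vertex, edge, ... belongs to a cell -/
  pure : ∀ s ∈ ref.faces, ∃ t ∈ cells, s ⊆ t
  /-- the ALE map `(t, Y) ↦ 𝒜ₜ(Y)` -/
  ale : ℝ → Space d → Space d
  ale_affine : ∀ t ∈ Icc 0 T, ∀ s ∈ cells,
    ∃ g : Space d →ᵃ[ℝ] Space d, EqOn (ale t) g (convexHull ℝ (s : Set (Space d)))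
  ale_injOn : ∀ t ∈ Icc 0 T, InjOn (ale t) ref.space
  ale_contDiffOn : ∀ Y ∈ ref.space, ContDiffOn ℝ 1 (fun t => ale t Y) (Icc 0 T)

namespace MovingMesh

variable {d : ℕ} {T : ℝ} (M : MovingMesh d T)

/-- The closed moving domain at time `t`. -/
def domain (t : ℝ) : Set (Space d) := M.ale t '' M.ref.space

/-- The cell `K` of the triangulation at time `t` that is the image of the reference cell with
vertex set `s`. -/
def cell (s : Finset (Space d)) (t : ℝ) : Set (Space d) :=
  M.ale t '' convexHull ℝ (s : Set (Space d))

/-- The diameter `h_{K,t}` of a cell. -/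
def cellDiam (s : Finset (Space d)) (t : ℝ) : ℝ := Metric.diam (M.cell s t)

/-- The closed space-time domain. -/
def spaceTime : Set (ℝ × Space d) := {p | p.1 ∈ Icc 0 T ∧ p.2 ∈ M.domain p.1}

/-- The reference point `𝒜ₜ⁻¹(x)`. -/
def aleInv (t : ℝ) (x : Space d) : Space d := Function.invFunOn (M.ale t) M.ref.space x

/-- The mesh velocity `w_h(t, x) = ∂ₜ 𝒜ₜ(Y)` at `Y = 𝒜ₜ⁻¹(x)`. -/
def velocity (t : ℝ) (x : Space d) : Space d :=
  derivWithin (fun τ => M.ale τ (M.aleInv t x)) (Icc 0 T) t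

/-- The time derivative `∂u/∂t|_Y` on the ALE frame, in Eulerian coordinates. -/
def aleDeriv (u : ℝ → Space d → ℝ) (t : ℝ) (x : Space d) : ℝ :=
  derivWithin (fun τ => u τ (M.ale τ (M.aleInv t x))) (Icc 0 T) t

/-- `v ∈ V_h` at time `t`: continuous on the closed domain, zero on its boundary, and on every
cell a polynomial of degree at most `k`. Values outside the domain are irrelevant. -/
structure IsFE (k : ℕ) (t : ℝ) (v : Space d → ℝ) : Prop where
  continuousOn : ContinuousOn v (M.domain t)
  boundary : ∀ x ∈ frontier (M.domain t), v x = 0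
  polynomial : ∀ s ∈ M.cells, ∃ p : MvPolynomial (Fin d) ℝ, p.totalDegree ≤ k ∧
    ∀ x ∈ M.cell s t, v x = MvPolynomial.eval (fun i => x i) p

end MovingMesh

variable {d : ℕ} {T : ℝ}

/-- The divergence of a vector field. -/
def divergence (b : Space d → Space d) (x : Space d) : ℝ :=
  ∑ i, (fderiv ℝ b x (EuclideanSpace.single i 1)) i

/-- The squared `L²`-norm on a set. -/
def normSq {F : Type*} [NormedAddCommGroup F] (S : Set (Space d)) (g : Space d → F) : ℝ :=
  ∫ x in S, ‖g x‖ ^ 2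

/-- The `L^∞`-norm on a set. -/
def supNorm (S : Set (Space d)) (g : Space d → ℝ) : ℝ :=
  (eLpNorm g ⊤ (volume.restrict S)).toReal

/-- The inverse inequality `‖Δv‖_{0,K} ≤ C h_K⁻¹ |v|_{1,K}` holds for all finite element functions,
all cells and all times. (Inside a cell, `v` is a polynomial, so its gradient and Laplacian there
are the elementwise ones; the boundaries of cells are null sets.) -/
def InverseInequality (M : MovingMesh d T) (k : ℕ) (C : ℝ) : Prop :=
  ∀ t ∈ Ioc 0 T, ∀ v, M.IsFE k t v → ∀ s ∈ M.cells,
    √(normSq (M.cell s t) (Laplacian.laplacian v))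
      ≤ C * (M.cellDiam s t)⁻¹ * √(normSq (M.cell s t) (gradient v))

/-- The data: diffusivity, convective velocity, reaction, source, and the local stabilization
parameters `δ_K(t)`, where a cell `K` is given by its reference vertices. -/
structure Data (d : ℕ) where
  ε : ℝ
  b : ℝ → Space d → Space d
  c : ℝ → Space d → ℝ
  f : ℝ → Space d → ℝ
  δ : Finset (Space d) → ℝ → ℝ

/-- The convective derivative `(b - w_h) · ∇v`. -/
def convect (M : MovingMesh d T) (D : Data d) (t : ℝ) (v : Space d → ℝ) (x : Space d) : ℝ :=
  inner ℝ (D.b t x - M.velocity t x) (gradient v x)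

/-- The form `a_SUPG(u, v)` at time `t`. -/
def aSUPG (M : MovingMesh d T) (D : Data d) (t : ℝ) (u v : Space d → ℝ) : ℝ :=
  D.ε * (∫ x in M.domain t, inner ℝ (gradient u x) (gradient v x))
    + (∫ x in M.domain t, inner ℝ (D.b t x) (gradient u x) * v x)
    + (∫ x in M.domain t, D.c t x * u x * v x)
    + ∑ s ∈ M.cells, D.δ s t * ∫ x in M.cell s t,
        (-D.ε * Laplacian.laplacian u x + convect M D t u x + D.c t x * u x)
          * convect M D t v x

/-- The squared mesh-dependent norm `|||u|||²` at time `t`. -/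
def tripleNormSq (M : MovingMesh d T) (D : Data d) (μ t : ℝ) (u : Space d → ℝ) : ℝ :=
  D.ε * normSq (M.domain t) (gradient u)
    + (∑ s ∈ M.cells, D.δ s t * normSq (M.cell s t) (convect M D t u))
    + μ * normSq (M.domain t) u

/-- `u` solves the semi-discrete (continuous in time) ALE-SUPG problem with initial datum `u₀`. -/
structure IsSemidiscreteSolution (M : MovingMesh d T) (k : ℕ) (D : Data d) (u₀ : Space d → ℝ)
    (u : ℝ → Space d → ℝ) : Prop where
  isFE : ∀ t ∈ Icc 0 T, M.IsFE k t (u t)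
  continuousOn : ∀ Y ∈ M.ref.space, ContinuousOn (fun t => u t (M.ale t Y)) (Icc 0 T)
  differentiableOn : ∀ Y ∈ M.ref.space, ∀ t ∈ Ioc 0 T,
    DifferentiableWithinAt ℝ (fun τ => u τ (M.ale τ Y)) (Icc 0 T) t
  /-- `u(0)` is the `L²`-projection of `u₀` onto the finite element space -/
  initial : ∀ v, M.IsFE k 0 v → ∫ x in M.domain 0, (u 0 x - u₀ x) * v x = 0
  equation : ∀ t ∈ Ioc 0 T, ∀ v, M.IsFE k t v →
    (∫ x in M.domain t, M.aleDeriv u t x * v x) + aSUPG M D t (u t) v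
        - (∫ x in M.domain t, inner ℝ (M.velocity t x) (gradient (u t) x) * v x)
      = (∫ x in M.domain t, D.f t x * v x)
        + ∑ s ∈ M.cells, D.δ s t * ∫ x in M.cell s t, D.f t x * convect M D t v x

/-- Standing regularity assumptions on the data. -/
structure Data.IsRegular (D : Data d) (M : MovingMesh d T) : Prop where
  ε_pos : 0 < D.ε
  b_continuousOn : ContinuousOn (fun p : ℝ × Space d => D.b p.1 p.2) M.spaceTime
  b_lipschitz : ∀ t ∈ Ioc 0 T, ∃ L : ℝ≥0, LipschitzOnWith L (D.b t) (M.domain t)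
  c_bounded : ∀ t ∈ Ioc 0 T, MemLp (D.c t) ⊤ (volume.restrict (M.domain t))
  f_memLp : ∀ t ∈ Ioc 0 T, MemLp (D.f t) 2 (volume.restrict (M.domain t))
  f_memLp_spaceTime :
    MemLp (fun p : ℝ × Space d => D.f p.1 p.2) 2 (volume.restrict M.spaceTime)
  δ_nonneg : ∀ s ∈ M.cells, ∀ t ∈ Ioc 0 T, 0 ≤ D.δ s t
  δ_measurable : ∀ s ∈ M.cells, AEMeasurable (D.δ s) (volume.restrict (Ioc 0 T))

end ALESUPG

end

/-!
Along the ALE frame `u` has fixed polynomial shapes on each reference cell, so Reynolds' theorem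
(Jacobi's formula for `det` of the affine cell map, at cell level) gives
`d/dt ‖u‖² = 2 (∂ₜu|_Y, u) + ∑_K ∫_K (∇ · w_h) u²`. As `u` vanishes on the boundary, the last sum
is `-2 (w_h · ∇u, u)`, so the scheme tested with `v = u` yields
`d/dt ‖u‖² = 2 (load(u) - a_SUPG(u, u))` and the mesh velocity drops out. The same integration by
parts applied to `b`, with the inverse inequality and the bounds on `δ_K`, gives
`a_SUPG(u, u) ≥ ½ |||u|||²`; Young's inequality bounds the load by the data plus `¼ |||u|||²`, and
integrating in time concludes.

The integration by parts needs no traces: `u² β` extended by zero is globally Lipschitz, and the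
partial derivatives of a compactly supported Lipschitz function have integral zero.
-/

namespace ALESUPG

/-! ### Nodal bases and polynomial functions -/

section

theorem exists_nodal_representation {𝕜 X : Type*} [Field 𝕜] (W : Submodule 𝕜 (X → 𝕜))
    [FiniteDimensional 𝕜 W] (S : Set X) :
    ∃ (n : ℕ) (Y : Fin n → X) (φ : Fin n → W), (∀ i, Y i ∈ S) ∧
      ∀ f ∈ W, ∀ x ∈ S, f x = ∑ i, f (Y i) * (φ i : X → 𝕜) x := by
  let ev : X → Module.Dual 𝕜 W := fun x => LinearMap.proj x ∘ₗ W.subtype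
  obtain ⟨B, hBS, hspan, hli⟩ := exists_linearIndependent 𝕜 (ev '' S)
  have : Fintype B := hli.setFinite.fintype
  choose Y hYS hY using fun b : B => hBS b.2
  let basis := Module.Basis.span hli
  choose ext hext using fun b : B => LinearMap.exists_extend (basis.coord b)
  let φ : B → W := fun b => (Module.evalEquiv 𝕜 W).symm (ext b)
  have hrepr : ∀ f : W, ∀ x ∈ S, f.1 x = ∑ b : B, f.1 (Y b) * (φ b).1 x := by
    intro f x hx
    have hmem : ev x ∈ Submodule.span 𝕜 (range ((↑) : B → Module.Dual 𝕜 W)) := by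
      rw [Subtype.range_coe, hspan]
      exact Submodule.subset_span (mem_image_of_mem ev hx)
    have hcoord : ∀ b, basis.coord b ⟨ev x, hmem⟩ = (φ b).1 x := fun b =>
      (LinearMap.congr_fun (hext b) ⟨ev x, hmem⟩).symm.trans
        (Module.apply_evalEquiv_symm_apply 𝕜 W (ev x) (ext b)).symm
    have hsum : ∑ b : B, basis.coord b ⟨ev x, hmem⟩ • (b : Module.Dual 𝕜 W) = ev x := by
      simpa only [Submodule.coe_sum, Submodule.coe_smul, basis, Module.Basis.span_apply]
        using! congrArg Subtype.val (basis.sum_repr ⟨ev x, hmem⟩)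
    calc f.1 x = ev x f := rfl
      _ = ∑ b : B, basis.coord b ⟨ev x, hmem⟩ * (b : Module.Dual 𝕜 W) f := by
        simpa only [LinearMap.sum_apply, LinearMap.smul_apply, smul_eq_mul]
          using (LinearMap.congr_fun hsum f).symm
      _ = ∑ b : B, f.1 (Y b) * (φ b).1 x := Finset.sum_congr rfl fun b _ => by
        rw [hcoord, ← hY, mul_comm]
        rfl
  let e := Fintype.equivFin B
  refine ⟨_, Y ∘ e.symm, φ ∘ e.symm, fun i => hYS _, fun f hf x hx => ?_⟩
  exact (hrepr ⟨f, hf⟩ x hx).trans (e.symm.sum_comp fun b => f (Y b) * (φ b).1 x).symm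

/-- The space of real polynomial functions on `ℝᵈ` of total degree at most `k`. -/
noncomputable def polynomialSpace (d k : ℕ) : Submodule ℝ (Space d → ℝ) :=
  (MvPolynomial.restrictTotalDegree (Fin d) ℝ k).map
    (LinearMap.pi fun y : Space d => (MvPolynomial.aeval fun i => y i).toLinearMap)

variable {d k : ℕ}

theorem mem_polynomialSpace {P : Space d → ℝ} :
    P ∈ polynomialSpace d k ↔
      ∃ p : MvPolynomial (Fin d) ℝ, p.totalDegree ≤ k ∧
        ∀ y, P y = MvPolynomial.eval (fun i => y i) p := by
  simp only [polynomialSpace, Submodule.mem_map, MvPolynomial.mem_restrictTotalDegree]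
  exact exists_congr fun p => and_congr_right fun _ => eq_comm.trans funext_iff

instance finiteDimensional_polynomialSpace : FiniteDimensional ℝ (polynomialSpace d k) := by
  unfold polynomialSpace
  infer_instance

theorem totalDegree_bind₁_le {R σ τ : Type*} [CommSemiring R] {ℓ : σ → MvPolynomial τ R}
    (hℓ : ∀ i, (ℓ i).totalDegree ≤ 1) (p : MvPolynomial σ R) :
    (MvPolynomial.bind₁ ℓ p).totalDegree ≤ p.totalDegree := by
  rw [MvPolynomial.bind₁, MvPolynomial.aeval_def, MvPolynomial.eval₂_eq]
  refine MvPolynomial.totalDegree_finsetSum_le fun m hm => ?_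
  calc (MvPolynomial.C (p.coeff m) * ∏ i ∈ m.support, ℓ i ^ m i).totalDegree
      ≤ (MvPolynomial.C (p.coeff m) : MvPolynomial τ R).totalDegree
          + (∏ i ∈ m.support, ℓ i ^ m i).totalDegree := MvPolynomial.totalDegree_mul _ _
    _ ≤ ∑ i ∈ m.support, (ℓ i ^ m i).totalDegree := by
      rw [MvPolynomial.totalDegree_C, zero_add]
      exact MvPolynomial.totalDegree_finsetProd _ _
    _ ≤ ∑ i ∈ m.support, m i := Finset.sum_le_sum fun i _ =>
      (MvPolynomial.totalDegree_pow _ _).trans (mul_le_of_le_one_right' (hℓ i))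
    _ ≤ p.totalDegree := MvPolynomial.le_totalDegree hm

theorem exists_mvPolynomial_eq_affine (g : Space d →L[ℝ] ℝ) (a : ℝ) :
    ∃ ℓ : MvPolynomial (Fin d) ℝ, ℓ.totalDegree ≤ 1 ∧
      ∀ y : Space d, MvPolynomial.eval (fun i => y i) ℓ = g y + a := by
  refine ⟨∑ j, MvPolynomial.C (g (EuclideanSpace.single j 1)) * MvPolynomial.X j
    + MvPolynomial.C a, ?_, fun y => ?_⟩
  · refine (MvPolynomial.totalDegree_add _ _).trans (max_le ?_ (by simp))
    refine MvPolynomial.totalDegree_finsetSum_le fun j _ => ?_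
    exact (MvPolynomial.totalDegree_mul _ _).trans (by simp)
  · have hy : y = ∑ j, y j • EuclideanSpace.single j (1 : ℝ) := by
      ext l
      simp [Finset.sum_apply, Pi.single_apply]
    conv_rhs => rw [hy]
    simp [mul_comm]

theorem comp_affine_mem_polynomialSpace {d' : ℕ} {P : Space d → ℝ} (hP : P ∈ polynomialSpace d k)
    (A : Space d' →L[ℝ] Space d) (a : Space d) :
    (fun y => P (A y + a)) ∈ polynomialSpace d' k := by
  obtain ⟨p, hp, hP⟩ := mem_polynomialSpace.1 hP
  choose ℓ hdeg hℓ using fun i =>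
    exists_mvPolynomial_eq_affine (EuclideanSpace.proj (𝕜 := ℝ) i ∘L A) (a i)
  refine mem_polynomialSpace.2
    ⟨MvPolynomial.bind₁ ℓ p, (totalDegree_bind₁_le hdeg p).trans hp, fun y => ?_⟩
  calc P (A y + a)
      = MvPolynomial.eval (fun i => MvPolynomial.eval (fun i => y i) (ℓ i)) p := by
        rw [hP, funext fun i => hℓ i y]
        rfl
    _ = MvPolynomial.eval (fun i => y i) (MvPolynomial.bind₁ ℓ p) :=
        (MvPolynomial.eval₂Hom_bind₁ _ _ _ _).symm

theorem contDiff_of_mem_polynomialSpace {n : WithTop ℕ∞} {P : Space d → ℝ}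
    (hP : P ∈ polynomialSpace d k) : ContDiff ℝ n P := by
  obtain ⟨p, -, hP⟩ := mem_polynomialSpace.1 hP
  suffices h : ∀ p : MvPolynomial (Fin d) ℝ,
      ContDiff ℝ n fun y : Space d => MvPolynomial.eval (fun i => y i) p by
    simpa only [funext hP] using h p
  intro p
  induction p using MvPolynomial.induction_on with
  | C a => simpa using contDiff_const
  | add p q hp hq => simpa using hp.add hq
  | mul_X p i hp =>
    have hi : ContDiff ℝ n fun y : Space d => y i := (EuclideanSpace.proj (𝕜 := ℝ) i).contDiff
    simpa using hp.mul hi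

end

/-! ### Piecewise Lipschitz functions -/

theorem exists_mem_and_frequently_mem_of_finite_closed_cover {ι : Type*} [Finite ι] {a b x : ℝ}
    {S : ι → Set ℝ} (hS : ∀ i, IsClosed (S i)) (hcover : Icc a b ⊆ ⋃ i, S i) (hx : x ∈ Ico a b) :
    ∃ i, x ∈ S i ∧ ∃ᶠ z in nhdsWithin x (Ioi x), z ∈ S i := by
  have hfreq : ∃ᶠ z in nhdsWithin x (Ioi x), ∃ i, z ∈ S i := by
    refine Filter.Eventually.frequently ?_
    filter_upwards [Ioo_mem_nhdsGT hx.2] with z hz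
    exact mem_iUnion.1 (hcover ⟨hx.1.trans hz.1.le, hz.2.le⟩)
  obtain ⟨i, hi⟩ := Filter.frequently_exists.1 hfreq
  refine ⟨i, ?_, hi⟩
  rw [← (hS i).closure_eq, mem_closure_iff_frequently]
  exact hi.filter_mono nhdsWithin_le_nhds

theorem norm_sub_le_of_finite_closed_cover {F ι : Type*} [NormedAddCommGroup F] [Finite ι]
    {f : ℝ → F} {a b : ℝ} (hab : a ≤ b) (hf : ContinuousOn f (Icc a b)) {C : ℝ≥0} {S : ι → Set ℝ}
    (hS : ∀ i, IsClosed (S i)) (hcover : Icc a b ⊆ ⋃ i, S i)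
    (hL : ∀ i, LipschitzOnWith C f (S i)) : ‖f b - f a‖ ≤ C * (b - a) := by
  refine image_le_of_liminf_slope_right_le_deriv_boundary (f := fun x => ‖f x - f a‖)
    (B := fun x => C * (x - a)) (B' := fun _ => C) (hf.sub continuousOn_const).norm (by simp)
    (by fun_prop) (fun x _ => ?_) (fun x hx r hr => ?_) (right_mem_Icc.2 hab)
  · simpa using (((hasDerivAt_id x).sub_const a).const_mul (C : ℝ)).hasDerivWithinAt
  · obtain ⟨i, hxi, hi⟩ := exists_mem_and_frequently_mem_of_finite_closed_cover hS hcover hx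
    refine (hi.and_eventually self_mem_nhdsWithin).mono fun z ⟨hz, hxz⟩ => ?_
    have hpos : 0 < z - x := sub_pos.2 hxz
    rw [slope_def_field, div_lt_iff₀ hpos]
    calc ‖f z - f a‖ - ‖f x - f a‖ ≤ ‖(f z - f a) - (f x - f a)‖ := norm_sub_norm_le _ _
      _ = dist (f z) (f x) := by rw [sub_sub_sub_cancel_right, dist_eq_norm]
      _ ≤ C * (z - x) := by
        simpa [Real.dist_eq, abs_of_pos hpos] using (hL i).dist_le_mul z hz x hxi
      _ < r * (z - x) := mul_lt_mul_of_pos_right hr hpos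

theorem lipschitzWith_of_finite_closed_cover {E F ι : Type*} [NormedAddCommGroup E]
    [NormedSpace ℝ E] [NormedAddCommGroup F] [Finite ι] {f : E → F} (hf : Continuous f) {C : ℝ≥0}
    {S : ι → Set E} (hS : ∀ i, IsClosed (S i)) (hcover : ⋃ i, S i = univ)
    (hL : ∀ i, LipschitzOnWith C f (S i)) : LipschitzWith C f := by
  refine LipschitzWith.of_dist_le_mul fun x y => ?_
  let γ : ℝ → E := fun r => AffineMap.lineMap y x r
  have hγ : LipschitzWith (nndist y x) γ := lipschitzWith_lineMap y x
  have hsub := norm_sub_le_of_finite_closed_cover (f := f ∘ γ) (S := fun i => γ ⁻¹' S i)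
    zero_le_one (hf.comp hγ.continuous).continuousOn (fun i => (hS i).preimage hγ.continuous)
    (by rw [← preimage_iUnion, hcover, preimage_univ]; exact subset_univ _)
    (fun i => (hL i).comp hγ.lipschitzOnWith (mapsTo_preimage γ (S i)))
  simpa [γ, dist_eq_norm, norm_sub_rev y x] using hsub

theorem exists_lipschitzOnWith_smul {E F : Type*} [PseudoMetricSpace E] [SeminormedAddCommGroup F]
    [NormedSpace ℝ F] {K : Set E} (hK : IsCompact K) {f : E → ℝ} {g : E → F} {Lf Lg : ℝ≥0}
    (hf : LipschitzOnWith Lf f K) (hg : LipschitzOnWith Lg g K) :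
    ∃ L, LipschitzOnWith L (fun x => f x • g x) K := by
  obtain ⟨A, hA⟩ := hK.exists_bound_of_continuousOn hf.continuousOn
  obtain ⟨B, hB⟩ := hK.exists_bound_of_continuousOn hg.continuousOn
  refine ⟨A.toNNReal * Lg + Lf * B.toNNReal, LipschitzOnWith.of_dist_le_mul fun x hx y hy => ?_⟩
  have hAx : ‖f x‖ ≤ A.toNNReal := (hA x hx).trans (Real.le_coe_toNNReal A)
  have hBy : ‖g y‖ ≤ B.toNNReal := (hB y hy).trans (Real.le_coe_toNNReal B)
  calc dist (f x • g x) (f y • g y)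
      = ‖f x • (g x - g y) + (f x - f y) • g y‖ := by
        rw [dist_eq_norm, smul_sub, sub_smul, sub_add_sub_cancel]
    _ ≤ ‖f x‖ * ‖g x - g y‖ + ‖f x - f y‖ * ‖g y‖ :=
        (norm_add_le _ _).trans_eq (by rw [norm_smul, norm_smul])
    _ ≤ A.toNNReal * (Lg * dist x y) + (Lf * dist x y) * B.toNNReal := by
        rw [← dist_eq_norm, ← dist_eq_norm]
        gcongr
        exacts [hg.dist_le_mul x hx y hy, hf.dist_le_mul x hx y hy]
    _ = ↑(A.toNNReal * Lg + Lf * B.toNNReal) * dist x y := by push_cast; ring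

theorem exists_lipschitzWith_indicator {E F ι : Type*} [NormedAddCommGroup E] [NormedSpace ℝ E]
    [NormedAddCommGroup F] [Finite ι] {K : Set E} (hK : IsClosed K) {S : ι → Set E}
    (hS : ∀ i, IsClosed (S i)) (hcover : K = ⋃ i, S i) {g : E → F} (hg : ContinuousOn g K)
    (hfr : ∀ x ∈ frontier K, g x = 0) (hL : ∀ i, ∃ L, LipschitzOnWith L g (S i)) :
    ∃ L, LipschitzWith L (K.indicator g) := by
  have := Fintype.ofFinite ι
  choose L hL using hL
  have hcont : Continuous (K.indicator g) := continuous_indicator hfr (by rwa [hK.closure_eq])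
  have hzero : EqOn (K.indicator g) 0 (closure Kᶜ) := fun x hx => by
    by_cases hxK : x ∈ K
    · rw [indicator_of_mem hxK]
      refine hfr x ?_
      rw [frontier_eq_closure_inter_closure]
      exact ⟨subset_closure hxK, hx⟩
    · exact indicator_of_notMem hxK g
  have hpiece (i : ι) : EqOn (K.indicator g) g (S i) := fun x hx =>
    indicator_of_mem (hcover ▸ mem_iUnion_of_mem i hx) g
  refine ⟨∑ i, L i, lipschitzWith_of_finite_closed_cover (ι := Option ι)
    (S := fun o => o.elim (closure Kᶜ) S) hcont (Option.rec isClosed_closure hS) ?_ ?_⟩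
  · rw [iUnion_option, ← compl_subset_iff_union]
    simp only [Option.elim, ← hcover]
    exact compl_subset_comm.1 subset_closure
  · rintro (_ | i) x hx y hy
    · rw [hzero hx, hzero hy, Pi.zero_apply, Pi.zero_apply, edist_self]
      exact zero_le
    · rw [hpiece i hx, hpiece i hy]
      exact (hL i).weaken (Finset.single_le_sum (fun _ _ => zero_le) (Finset.mem_univ i)) hx hy

/-! ### Jacobi's formula -/

section Jacobi

variable {E : Type*} [NormedAddCommGroup E] [NormedSpace ℝ E] [FiniteDimensional ℝ E]

theorem differentiable_det : Differentiable ℝ fun A : E →L[ℝ] E => A.det := by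
  let B := Module.finBasis ℝ E
  have hentry : ∀ i j, Differentiable ℝ fun A : E →L[ℝ] E => B.coord i (A (B j)) := fun i j =>
    ((B.coord i).toContinuousLinearMap ∘L ContinuousLinearMap.apply ℝ E (B j)).differentiable
  have hdet : (fun A : E →L[ℝ] E => A.det) = fun A => ∑ σ : Equiv.Perm _,
      ((Equiv.Perm.sign σ : ℤ) : ℝ) * ∏ i, B.coord (σ i) (A (B i)) := by
    ext A
    rw [ContinuousLinearMap.det, ← LinearMap.det_toMatrix B, Matrix.det_apply']
    simp only [LinearMap.toMatrix_apply, Module.Basis.coord_apply, ContinuousLinearMap.coe_coe]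
  rw [hdet]
  refine Differentiable.fun_sum fun σ _ => Differentiable.const_mul (fun A => ?_) _
  exact (HasFDerivAt.finsetProd fun i _ => (hentry (σ i) i A).hasFDerivAt).differentiableAt

theorem hasDerivAt_det_one_add_smul (A : E →L[ℝ] E) :
    HasDerivAt (fun r : ℝ => (1 + r • A).det) (LinearMap.trace ℝ E A) 0 := by
  let B := Module.finBasis ℝ E
  let N := LinearMap.toMatrix B B (A : E →ₗ[ℝ] E)
  have hdet : ∀ r : ℝ, (1 + r • A).det = (1 + r • N).det := fun r => by
    rw [ContinuousLinearMap.det, ← LinearMap.det_toMatrix B]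
    simp [N, ContinuousLinearMap.one_def]
  rw [funext fun r => (hdet r).trans (Matrix.det_one_add_smul r N)]
  generalize (Matrix.det (1 + (Polynomial.X : Polynomial ℝ) • N.map Polynomial.C)).divX.divX = q
  have hquad := (q.hasDerivAt 0).fun_mul ((hasDerivAt_id (0 : ℝ)).fun_pow 2)
  have hderiv := (((hasDerivAt_id (0 : ℝ)).const_mul N.trace).const_add 1).fun_add hquad
  rw [LinearMap.trace_eq_matrix_trace ℝ B]
  simpa [N] using hderiv

theorem fderiv_det_one (A : E →L[ℝ] E) :
    fderiv ℝ (fun A : E →L[ℝ] E => A.det) 1 A = LinearMap.trace ℝ E A := by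
  have hline : HasDerivAt (fun r : ℝ => 1 + r • A) A 0 := by
    simpa using ((hasDerivAt_id (0 : ℝ)).smul_const A).const_add 1
  have hdet : HasFDerivAt (fun A : E →L[ℝ] E => A.det) (fderiv ℝ (fun A : E →L[ℝ] E => A.det) 1)
      (1 + (0 : ℝ) • A) := by
    rw [zero_smul, add_zero]
    exact (differentiable_det 1).hasFDerivAt
  have hcomp := hdet.comp_hasDerivAt (0 : ℝ) hline
  exact hcomp.unique (hasDerivAt_det_one_add_smul A)

theorem hasDerivWithinAt_det {J : ℝ → E →L[ℝ] E} {J' I : E →L[ℝ] E} {S : Set ℝ} {t : ℝ}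
    (hJ : HasDerivWithinAt J J' S t) (hJI : J t * I = 1) (hIJ : I * J t = 1) :
    HasDerivWithinAt (fun s => (J s).det)
      (LinearMap.trace ℝ E (J' * I : E →L[ℝ] E) * (J t).det) S t := by
  have hdet : HasFDerivAt (fun A : E →L[ℝ] E => A.det) (fderiv ℝ (fun A : E →L[ℝ] E => A.det) 1)
      (J t * I) := by
    rw [hJI]
    exact (differentiable_det 1).hasFDerivAt
  have hfactor : ∀ s, (J s).det = (J s * I).det * (J t).det := fun s => by
    conv_lhs => rw [← mul_one (J s), ← hIJ, ← mul_assoc]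
    exact LinearMap.det_comp _ _
  have hderiv := (hdet.comp_hasDerivWithinAt t (hJ.mul_const I)).mul_const (J t).det
  rw [fderiv_det_one] at hderiv
  rw [funext hfactor]
  exact hderiv

end Jacobi

/-! ### Integration -/

theorem memLp_of_continuousOn_of_isCompact {X F : Type*} [TopologicalSpace X] [MeasurableSpace X]
    [OpensMeasurableSpace X] [T2Space X] [SecondCountableTopology X] [NormedAddCommGroup F]
    {μ : Measure X} [IsFiniteMeasureOnCompacts μ] {K : Set X} (hK : IsCompact K) {f : X → F}
    (hf : ContinuousOn f K) (p : ENNReal) : MemLp f p (μ.restrict K) := by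
  have : IsFiniteMeasure (μ.restrict K) := ⟨by simpa using hK.measure_lt_top⟩
  obtain ⟨C, hC⟩ := hK.exists_bound_of_continuousOn hf
  refine .of_bound (hf.aestronglyMeasurable_of_isCompact hK hK.measurableSet) C ?_
  filter_upwards [ae_restrict_mem hK.measurableSet] with x hx using hC x hx

theorem continuousOn_integral_of_isCompact {X Y F : Type*} [TopologicalSpace X]
    [FirstCountableTopology X] [TopologicalSpace Y] [MeasurableSpace Y] [OpensMeasurableSpace Y]
    [T2Space Y] [NormedAddCommGroup F] [NormedSpace ℝ F]
    {μ : Measure Y} [IsFiniteMeasureOnCompacts μ] {S : Set X} {K : Set Y} (hS : IsCompact S)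
    (hK : IsCompact K) {h : X → Y → F} (hc : ContinuousOn (fun p : X × Y => h p.1 p.2) (S ×ˢ K)) :
    ContinuousOn (fun t => ∫ y in K, h t y ∂μ) S := by
  obtain ⟨C, hC⟩ := (hS.prod hK).exists_bound_of_continuousOn hc
  refine continuousOn_of_dominated (bound := fun _ => C) (fun t ht => ?_) (fun t ht => ?_)
    (integrableOn_const hK.measure_lt_top.ne) ?_
  · refine ContinuousOn.aestronglyMeasurable_of_isCompact ?_ hK hK.measurableSet
    exact hc.comp (f := fun y => (t, y)) (by fun_prop) fun y hy => ⟨ht, hy⟩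
  · filter_upwards [ae_restrict_mem hK.measurableSet] with y hy using hC (t, y) ⟨ht, hy⟩
  · filter_upwards [ae_restrict_mem hK.measurableSet] with y hy
    exact hc.comp (f := fun t => (t, y)) (by fun_prop) fun t ht => ⟨ht, hy⟩

theorem ae_restrict_mem_interior_of_convex {E : Type*} [NormedAddCommGroup E] [NormedSpace ℝ E]
    [FiniteDimensional ℝ E] [MeasurableSpace E] [BorelSpace E] (μ : Measure E)
    [μ.IsAddHaarMeasure] {K : Set E} (hK : Convex ℝ K) (hm : MeasurableSet K) :
    ∀ᵐ x ∂μ.restrict K, x ∈ interior K := by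
  filter_upwards [ae_restrict_of_ae (measure_eq_zero_iff_ae_notMem.1 (hK.addHaar_frontier μ)),
    ae_restrict_mem hm] with x hx hxK
  by_contra hint
  exact hx ⟨subset_closure hxK, hint⟩

section Square

variable {α : Type*} [MeasurableSpace α] {μ : Measure α}

theorem integral_sum_mul_sum {ι : Type*} [Fintype ι] {φ : ι → α → ℝ} (hφ : ∀ i, MemLp (φ i) 2 μ)
    (a b : ι → ℝ) :
    ∫ x, (∑ i, a i * φ i x) * (∑ j, b j * φ j x) ∂μ
      = ∑ i, ∑ j, a i * b j * ∫ x, φ i x * φ j x ∂μ := by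
  have hint : ∀ i j, Integrable (fun x => a i * b j * (φ i x * φ j x)) μ := fun i j =>
    ((hφ i).integrable_mul (hφ j)).const_mul _
  simp only [Finset.sum_mul_sum, fun i j x => mul_mul_mul_comm (a i) (φ i x) (b j) (φ j x)]
  rw [integral_finsetSum _ fun i _ => integrable_finsetSum _ fun j _ => hint i j]
  refine Finset.sum_congr rfl fun i _ => ?_
  rw [integral_finsetSum _ fun j _ => hint i j]
  exact Finset.sum_congr rfl fun j _ => integral_const_mul _ _

theorem hasDerivWithinAt_integral_sum_sq {ι : Type*} [Fintype ι] {φ : ι → α → ℝ}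
    (hφ : ∀ i, MemLp (φ i) 2 μ) {c : ℝ → ι → ℝ} {c' : ι → ℝ} {S : Set ℝ} {t : ℝ}
    (hc : ∀ i, HasDerivWithinAt (fun s => c s i) (c' i) S t) :
    HasDerivWithinAt (fun s => ∫ x, (∑ i, c s i * φ i x) ^ 2 ∂μ)
      (2 * ∫ x, (∑ i, c' i * φ i x) * (∑ i, c t i * φ i x) ∂μ) S t := by
  simp only [sq, integral_sum_mul_sum hφ]
  have hprod : ∀ i j, HasDerivWithinAt (fun s => c s i * c s j * ∫ x, φ i x * φ j x ∂μ)
      ((c' i * c t j + c t i * c' j) * ∫ x, φ i x * φ j x ∂μ) S t := fun i j =>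
    ((hc i).fun_mul (hc j)).mul_const _
  refine (HasDerivWithinAt.fun_sum fun i _ =>
    HasDerivWithinAt.fun_sum fun j _ => hprod i j).congr_deriv ?_
  have hswap : ∑ i, ∑ j, c t i * c' j * ∫ x, φ i x * φ j x ∂μ
      = ∑ i, ∑ j, c' i * c t j * ∫ x, φ i x * φ j x ∂μ := by
    rw [Finset.sum_comm]
    refine Finset.sum_congr rfl fun i _ => Finset.sum_congr rfl fun j _ => ?_
    rw [mul_comm (c t j), funext fun x => mul_comm (φ j x) (φ i x)]
  simp only [add_mul, Finset.sum_add_distrib, hswap, two_mul]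

theorem integral_mul_le_of_memLp_two {f g : α → ℝ} (hf : MemLp f 2 μ) (hg : MemLp g 2 μ) {r : ℝ}
    (hr : 0 < r) : ∫ x, f x * g x ∂μ ≤ r * ∫ x, f x ^ 2 ∂μ + (4 * r)⁻¹ * ∫ x, g x ^ 2 ∂μ := by
  have hyoung : ∀ x, f x * g x ≤ r * f x ^ 2 + (4 * r)⁻¹ * g x ^ 2 := fun x => by
    have hsq : r * f x ^ 2 + (4 * r)⁻¹ * g x ^ 2 - f x * g x = r * (f x - g x / (2 * r)) ^ 2 := by
      field_simp
      ring
    nlinarith [mul_nonneg hr.le (sq_nonneg (f x - g x / (2 * r)))]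
  rw [← integral_const_mul, ← integral_const_mul, ← integral_add (hf.integrable_sq.const_mul r)
    (hg.integrable_sq.const_mul _)]
  exact integral_mono (hf.integrable_mul hg)
    ((hf.integrable_sq.const_mul r).add (hg.integrable_sq.const_mul _)) hyoung

end Square

theorem le_add_integral_of_hasDerivWithinAt_le {T τ : ℝ} {g g' φ : ℝ → ℝ}
    (hg : ContinuousOn g (Icc 0 T)) (hg' : ∀ t ∈ Ioc 0 T, HasDerivWithinAt g (g' t) (Icc 0 T) t)
    (hφ : IntervalIntegrable φ volume 0 τ) (hle : ∀ t ∈ Ioc 0 T, g' t ≤ φ t)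
    (hτ : τ ∈ Icc 0 T) : g τ ≤ g 0 + ∫ t in (0 : ℝ)..τ, φ t := by
  have hFTC := intervalIntegral.sub_le_integral_of_hasDeriv_right_of_le hτ.1
    (hg.mono (Icc_subset_Icc_right hτ.2))
    (fun t ht => ((hg' t ⟨ht.1, ht.2.le.trans hτ.2⟩).hasDerivAt
      (Icc_mem_nhds ht.1 (ht.2.trans_le hτ.2))).hasDerivWithinAt)
    ((intervalIntegrable_iff_integrableOn_Icc_of_le hτ.1).1 hφ)
    (fun t ht => hle t ⟨ht.1, ht.2.le.trans hτ.2⟩)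
  linarith

/-! ### Geometry of the moving mesh -/

/-- The reference cell with vertex set `s`. -/
abbrev refCell {d : ℕ} (s : Finset (Space d)) : Set (Space d) := convexHull ℝ (s : Set (Space d))

theorem isCompact_refCell {d : ℕ} (s : Finset (Space d)) : IsCompact (refCell s) :=
  s.finite_toSet.isCompact_convexHull ℝ

theorem ae_mem_interior_refCell {d : ℕ} (s : Finset (Space d)) :
    ∀ᵐ Y ∂volume.restrict (refCell s), Y ∈ interior (refCell s) :=
  ae_restrict_mem_interior_of_convex volume (convex_convexHull ℝ _)
    (isCompact_refCell s).measurableSet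

namespace MovingMesh

variable {d : ℕ} {T : ℝ} {M : MovingMesh d T} {s s' : Finset (Space d)} {t : ℝ}

theorem refCell_subset_space (hs : s ∈ M.cells) : refCell s ⊆ M.ref.space :=
  Geometry.SimplicialComplex.convexHull_subset_space ((M.mem_cells s).1 hs).1

theorem space_eq_biUnion_refCell (M : MovingMesh d T) :
    M.ref.space = ⋃ s ∈ M.cells, refCell s := by
  refine Subset.antisymm (fun x hx => ?_) (iUnion₂_subset fun s hs => refCell_subset_space hs)
  obtain ⟨f, hf, hx⟩ := Geometry.SimplicialComplex.mem_space_iff.1 hx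
  obtain ⟨s, hs, hfs⟩ := M.pure f hf
  exact mem_iUnion₂.2 ⟨s, hs, convexHull_mono (Finset.coe_subset.2 hfs) hx⟩

theorem domain_eq_biUnion_cell (M : MovingMesh d T) (t : ℝ) :
    M.domain t = ⋃ s ∈ M.cells, M.cell s t := by
  simp only [domain, space_eq_biUnion_refCell, image_iUnion₂, cell]

theorem cell_subset_domain (hs : s ∈ M.cells) (t : ℝ) : M.cell s t ⊆ M.domain t :=
  image_mono (refCell_subset_space hs)

theorem aleInv_ale (ht : t ∈ Icc 0 T) {Y : Space d} (hY : Y ∈ M.ref.space) :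
    M.aleInv t (M.ale t Y) = Y :=
  (M.ale_injOn t ht).leftInvOn_invFunOn hY

theorem affineSpan_vertices (hs : s ∈ M.cells) :
    affineSpan ℝ (range ((↑) : s → Space d)) = ⊤ := by
  obtain ⟨hface, hcard⟩ := (M.mem_cells s).1 hs
  rw [(M.ref.indep hface).affineSpan_eq_top_iff_card_eq_finrank_add_one]
  simpa using hcard

theorem interior_refCell_nonempty (hs : s ∈ M.cells) : (interior (refCell s)).Nonempty := by
  rw [interior_convexHull_nonempty_iff_affineSpan_eq_top]
  simpa using affineSpan_vertices hs

theorem volume_refCell_inter (hs : s ∈ M.cells) (hs' : s' ∈ M.cells) (hne : s ≠ s') :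
    volume (refCell s ∩ refCell s') = 0 := by
  obtain ⟨hface, hcard⟩ := (M.mem_cells s).1 hs
  obtain ⟨hface', hcard'⟩ := (M.mem_cells s').1 hs'
  refine measure_mono_null (M.ref.inter_subset_convexHull hface hface') ?_
  obtain ⟨v, hv, hv'⟩ : ∃ v ∈ s, v ∉ s' := by
    by_contra! hsub
    exact hne (Finset.eq_of_subset_of_card_le hsub (hcard'.trans hcard.symm).le)
  refine measure_mono_null (convexHull_subset_affineSpan _)
    (Measure.addHaar_affineSubspace volume _ fun htop => ?_)
  refine (M.ref.indep hface).notMem_affineSpan_sdiff ⟨v, hv⟩ univ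
    (affineSpan_mono ℝ (s₁ := (s ∩ s' : Set (Space d))) ?_ (htop ▸ AffineSubspace.mem_top ..))
  rintro x ⟨hx, hx'⟩
  refine ⟨⟨x, hx⟩, ⟨mem_univ _, fun h => ?_⟩, rfl⟩
  obtain rfl : x = v := congrArg Subtype.val h
  exact hv' hx'

/-- A parametrization of the moving cell `M.cell s t` over its reference cell by the affine maps
`Y ↦ lin t Y + shift t`, whose coefficients are `C¹` in time. -/
structure CellChart (M : MovingMesh d T) (s : Finset (Space d)) where
  mem_cells : s ∈ M.cells
  lin : ℝ → Space d →L[ℝ] Space d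
  shift : ℝ → Space d
  contDiffOn_lin : ContDiffOn ℝ 1 lin (Icc 0 T)
  contDiffOn_shift : ContDiffOn ℝ 1 shift (Icc 0 T)
  ale_eq : ∀ t ∈ Icc 0 T, ∀ Y ∈ refCell s, M.ale t Y = lin t Y + shift t

theorem nonempty_cellChart (hs : s ∈ M.cells) : Nonempty (M.CellChart s) := by
  let b : AffineBasis s ℝ (Space d) :=
    ⟨((↑) : s → Space d), M.ref.indep ((M.mem_cells s).1 hs).1, affineSpan_vertices hs⟩
  let ℓ : s → Space d →L[ℝ] ℝ := fun v => LinearMap.toContinuousLinearMap (b.coord v).linear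
  have coord_eq (v : s) (Y : Space d) : b.coord v Y = ℓ v Y + b.coord v 0 := by
    simpa [ℓ] using (b.coord v).map_vadd 0 Y
  have contDiffOn_vertex (v : s) : ContDiffOn ℝ 1 (fun t => M.ale t v) (Icc 0 T) :=
    M.ale_contDiffOn v (refCell_subset_space hs (subset_convexHull ℝ _ v.2))
  refine ⟨{
    mem_cells := hs
    lin := fun t => ∑ v : s, (ℓ v).smulRight (M.ale t v)
    shift := fun t => ∑ v : s, b.coord v 0 • M.ale t v
    contDiffOn_lin := ContDiffOn.sum fun v _ =>
      (ContinuousLinearMap.smulRightL ℝ (Space d) (Space d) (ℓ v)).contDiff.comp_contDiffOn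
        (contDiffOn_vertex v)
    contDiffOn_shift := ContDiffOn.sum fun v _ => (contDiffOn_vertex v).const_smul _
    ale_eq := fun t ht Y hY => ?_ }⟩
  obtain ⟨g, hg⟩ := M.ale_affine t ht s hs
  have ale_vertex (v : s) : M.ale t v = g v := hg (subset_convexHull ℝ _ v.2)
  have g_eq : g Y = ∑ v : s, b.coord v Y • g v := by
    conv_lhs => rw [← b.affineCombination_coord_eq_self Y]
    rw [Finset.map_affineCombination _ _ _ (b.sum_coord_apply_eq_one Y),
      Finset.affineCombination_eq_linear_combination _ _ _ (b.sum_coord_apply_eq_one Y)]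
    rfl
  rw [hg hY, g_eq]
  simp only [ale_vertex, sum_apply, ContinuousLinearMap.smulRight_apply,
    ← Finset.sum_add_distrib, ← add_smul, ← coord_eq]

namespace CellChart

variable (C : M.CellChart s)

/-- The affine map of the whole space that agrees with the ALE map on the reference cell. -/
def map (t : ℝ) (Y : Space d) : Space d := C.lin t Y + C.shift t

/-- The inverse of the linear part of a chart. -/
noncomputable def linInv (t : ℝ) : Space d →L[ℝ] Space d := Ring.inverse (C.lin t)

/-- The time derivative of the linear part of a chart. -/
noncomputable def linDeriv (t : ℝ) : Space d →L[ℝ] Space d := derivWithin C.lin (Icc 0 T) t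

/-- The time derivative of the translation part of a chart. -/
noncomputable def shiftDeriv (t : ℝ) : Space d := derivWithin C.shift (Icc 0 T) t

theorem continuousOn_lin : ContinuousOn C.lin (Icc 0 T) := C.contDiffOn_lin.continuousOn

theorem continuousOn_shift : ContinuousOn C.shift (Icc 0 T) := C.contDiffOn_shift.continuousOn

theorem hasDerivWithinAt_lin (ht : t ∈ Icc 0 T) :
    HasDerivWithinAt C.lin (C.linDeriv t) (Icc 0 T) t :=
  (C.contDiffOn_lin.differentiableOn one_ne_zero t ht).hasDerivWithinAt

theorem hasDerivWithinAt_shift (ht : t ∈ Icc 0 T) :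
    HasDerivWithinAt C.shift (C.shiftDeriv t) (Icc 0 T) t :=
  (C.contDiffOn_shift.differentiableOn one_ne_zero t ht).hasDerivWithinAt

theorem continuousOn_linDeriv (hT : 0 < T) : ContinuousOn C.linDeriv (Icc 0 T) :=
  C.contDiffOn_lin.continuousOn_derivWithin (uniqueDiffOn_Icc hT) le_rfl

theorem continuousOn_shiftDeriv (hT : 0 < T) : ContinuousOn C.shiftDeriv (Icc 0 T) :=
  C.contDiffOn_shift.continuousOn_derivWithin (uniqueDiffOn_Icc hT) le_rfl

theorem injective_lin (ht : t ∈ Icc 0 T) : Function.Injective (C.lin t) := by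
  rw [injective_iff_map_eq_zero]
  intro v hv
  obtain ⟨Y, hY⟩ := interior_refCell_nonempty C.mem_cells
  have hlim : Filter.Tendsto (fun r : ℝ => Y + r • v) (nhdsWithin 0 (Ioi 0)) (nhds Y) := by
    have hcont : Continuous fun r : ℝ => Y + r • v := by fun_prop
    simpa using (hcont.tendsto 0).mono_left nhdsWithin_le_nhds
  obtain ⟨r, hr, hr_pos⟩ := ((hlim.eventually (mem_interior_iff_mem_nhds.1 hY)).and
    self_mem_nhdsWithin).exists
  have hY := interior_subset hY
  have hale : M.ale t (Y + r • v) = M.ale t Y := by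
    rw [C.ale_eq t ht _ hr, C.ale_eq t ht _ hY, map_add, map_smul, hv, smul_zero, add_zero]
  have hrv : Y + r • v = Y := M.ale_injOn t ht (refCell_subset_space C.mem_cells hr)
    (refCell_subset_space C.mem_cells hY) hale
  exact (smul_eq_zero.1 (add_eq_left.1 hrv)).resolve_left (ne_of_gt hr_pos)

theorem isUnit_lin (ht : t ∈ Icc 0 T) : IsUnit (C.lin t) :=
  (ContinuousLinearEquiv.toUnit (LinearEquiv.ofInjectiveEndo (C.lin t : Space d →ₗ[ℝ] Space d)
    (C.injective_lin ht)).toContinuousLinearEquiv).isUnit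

theorem lin_mul_linInv (ht : t ∈ Icc 0 T) : C.lin t * C.linInv t = 1 :=
  Ring.mul_inverse_cancel _ (C.isUnit_lin ht)

theorem linInv_mul_lin (ht : t ∈ Icc 0 T) : C.linInv t * C.lin t = 1 :=
  Ring.inverse_mul_cancel _ (C.isUnit_lin ht)

theorem lin_linInv_apply (ht : t ∈ Icc 0 T) (x : Space d) : C.lin t (C.linInv t x) = x :=
  congrArg (fun L : Space d →L[ℝ] Space d => L x) (C.lin_mul_linInv ht)

theorem linInv_lin_apply (ht : t ∈ Icc 0 T) (x : Space d) : C.linInv t (C.lin t x) = x :=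
  congrArg (fun L : Space d →L[ℝ] Space d => L x) (C.linInv_mul_lin ht)

theorem continuousOn_linInv : ContinuousOn C.linInv (Icc 0 T) := fun t ht => by
  have h := NormedRing.inverse_continuousAt (C.isUnit_lin ht).unit
  rw [IsUnit.unit_spec] at h
  exact h.comp_continuousWithinAt (C.continuousOn_lin t ht)

theorem det_lin_ne_zero (ht : t ∈ Icc 0 T) : (C.lin t).det ≠ 0 :=
  (LinearMap.isUnit_det _ ((C.isUnit_lin ht).map ContinuousLinearMap.toLinearMapRingHom)).ne_zero

theorem continuousOn_det_lin : ContinuousOn (fun t => (C.lin t).det) (Icc 0 T) :=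
  ContinuousLinearMap.continuous_det.comp_continuousOn C.continuousOn_lin

theorem continuousOn_map :
    ContinuousOn (fun p : ℝ × Space d => C.map p.1 p.2) (Icc 0 T ×ˢ univ) :=
  ((C.continuousOn_lin.comp continuousOn_fst fun _ hp => hp.1).clm_apply continuousOn_snd).add
    (C.continuousOn_shift.comp continuousOn_fst fun _ hp => hp.1)

/-- The affine map of a chart as a homeomorphism of the whole space. -/
noncomputable def homeomorph (ht : t ∈ Icc 0 T) : Space d ≃ₜ Space d where
  toFun := C.map t
  invFun x := C.linInv t (x - C.shift t)
  left_inv Y := by simp [map, C.linInv_lin_apply ht]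
  right_inv x := by simp [map, C.lin_linInv_apply ht]
  continuous_toFun := by unfold map; fun_prop
  continuous_invFun := by fun_prop

theorem cell_eq_image (ht : t ∈ Icc 0 T) : M.cell s t = C.map t '' refCell s :=
  image_congr fun Y hY => C.ale_eq t ht Y hY

theorem interior_cell (ht : t ∈ Icc 0 T) :
    interior (M.cell s t) = C.map t '' interior (refCell s) := by
  rw [C.cell_eq_image ht]
  exact ((C.homeomorph ht).image_interior _).symm

theorem integral_cell (ht : t ∈ Icc 0 T) (g : Space d → ℝ) :
    ∫ x in M.cell s t, g x = |(C.lin t).det| * ∫ Y in refCell s, g (C.map t Y) := by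
  rw [C.cell_eq_image ht, integral_image_eq_integral_abs_det_fderiv_smul volume
    (isCompact_refCell s).measurableSet (f' := fun _ => C.lin t)
    (f := C.map t) (fun x _ => ((C.lin t).hasFDerivAt.add_const (C.shift t)).hasFDerivWithinAt)
    (C.homeomorph ht).injective.injOn]
  simp only [smul_eq_mul, integral_const_mul]

theorem integral_cell_of_eqOn_interior (ht : t ∈ Icc 0 T) {g h : Space d → ℝ}
    (hgh : ∀ Y ∈ interior (refCell s), g (C.map t Y) = h Y) :
    ∫ x in M.cell s t, g x = |(C.lin t).det| * ∫ Y in refCell s, h Y := by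
  rw [C.integral_cell ht,
    integral_congr_ae ((ae_mem_interior_refCell s).mono fun Y hY => hgh Y hY)]

theorem aleInv_map (ht : t ∈ Icc 0 T) {Y : Space d} (hY : Y ∈ refCell s) :
    M.aleInv t (C.map t Y) = Y := by
  rw [map, ← C.ale_eq t ht Y hY, aleInv_ale ht (refCell_subset_space C.mem_cells hY)]

end CellChart

theorem isCompact_cell (hs : s ∈ M.cells) (ht : t ∈ Icc 0 T) : IsCompact (M.cell s t) := by
  obtain ⟨C⟩ := nonempty_cellChart hs
  rw [C.cell_eq_image ht]
  exact (isCompact_refCell s).image (C.homeomorph ht).continuous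

theorem convex_cell (hs : s ∈ M.cells) (ht : t ∈ Icc 0 T) : Convex ℝ (M.cell s t) := by
  obtain ⟨C⟩ := nonempty_cellChart hs
  have himage : M.cell s t =
      (C.shift t + ·) '' ((C.lin t : Space d →ₗ[ℝ] Space d) '' refCell s) := by
    rw [C.cell_eq_image ht, image_image]
    exact image_congr fun Y _ => add_comm _ _
  rw [himage]
  exact ((convex_convexHull ℝ _).linear_image _).translate _

theorem ae_mem_interior_cell (hs : s ∈ M.cells) (ht : t ∈ Icc 0 T) :
    ∀ᵐ x ∂volume.restrict (M.cell s t), x ∈ interior (M.cell s t) :=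
  ae_restrict_mem_interior_of_convex volume (convex_cell hs ht) (isCompact_cell hs ht).measurableSet

theorem aedisjoint_cell (hs : s ∈ M.cells) (hs' : s' ∈ M.cells) (hne : s ≠ s')
    (ht : t ∈ Icc 0 T) : AEDisjoint volume (M.cell s t) (M.cell s' t) := by
  obtain ⟨C⟩ := nonempty_cellChart hs
  have hinter : M.cell s t ∩ M.cell s' t = C.map t '' (refCell s ∩ refCell s') := by
    rw [cell, cell, ← (M.ale_injOn t ht).image_inter (refCell_subset_space hs)
      (refCell_subset_space hs')]
    exact image_congr fun Y hY => C.ale_eq t ht Y hY.1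
  rw [AEDisjoint, hinter]
  exact addHaar_image_eq_zero_of_differentiableOn_of_addHaar_eq_zero volume
    ((C.lin t).differentiable.add_const (C.shift t)).differentiableOn
    (volume_refCell_inter hs hs' hne)

theorem isCompact_domain (ht : t ∈ Icc 0 T) : IsCompact (M.domain t) := by
  rw [domain_eq_biUnion_cell]
  exact M.cells.isCompact_biUnion fun s hs => isCompact_cell hs ht

theorem restrict_domain (ht : t ∈ Icc 0 T) :
    volume.restrict (M.domain t) = ∑ s ∈ M.cells, volume.restrict (M.cell s t) := by
  have hdomain : M.domain t = ⋃ s : M.cells, M.cell s t := by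
    rw [domain_eq_biUnion_cell, iUnion_subtype]
  rw [hdomain, Measure.restrict_iUnion_ae
    (fun s s' hne => aedisjoint_cell s.2 s'.2 (Subtype.coe_ne_coe.2 hne) ht)
    fun s => (isCompact_cell s.2 ht).measurableSet.nullMeasurableSet]
  exact Measure.sum_coe_finset M.cells fun s => volume.restrict (M.cell s t)

theorem ae_domain_iff (ht : t ∈ Icc 0 T) {P : Space d → Prop} :
    (∀ᵐ x ∂volume.restrict (M.domain t), P x) ↔
      ∀ s ∈ M.cells, ∀ᵐ x ∂volume.restrict (M.cell s t), P x := by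
  rw [restrict_domain ht, ae_finsetSum_measure_iff]

theorem integrableOn_domain_iff (ht : t ∈ Icc 0 T) {g : Space d → ℝ} :
    IntegrableOn g (M.domain t) ↔ ∀ s ∈ M.cells, IntegrableOn g (M.cell s t) := by
  rw [IntegrableOn, restrict_domain ht, integrable_finsetSum_measure]
  rfl

theorem integral_domain (ht : t ∈ Icc 0 T) {g : Space d → ℝ}
    (hg : ∀ s ∈ M.cells, IntegrableOn g (M.cell s t)) :
    ∫ x in M.domain t, g x = ∑ s ∈ M.cells, ∫ x in M.cell s t, g x := by
  rw [restrict_domain ht, integral_finsetSum_measure hg]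

end MovingMesh

/-! ### Differential operators, mesh velocity and finite element functions -/

section Operators

variable {E : Type*} [NormedAddCommGroup E] [InnerProductSpace ℝ E]

theorem continuous_gradient_of_contDiff [CompleteSpace E] {f : E → ℝ} (hf : ContDiff ℝ 1 f) :
    Continuous (gradient f) :=
  (InnerProductSpace.toDual ℝ E).symm.continuous.comp (hf.continuous_fderiv one_ne_zero)

theorem continuous_laplacian_of_contDiff [FiniteDimensional ℝ E] {F : Type*}
    [NormedAddCommGroup F] [NormedSpace ℝ F] {f : E → F} (hf : ContDiff ℝ 2 f) :
    Continuous (Laplacian.laplacian f) := by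
  rw [InnerProductSpace.laplacian_eq_iteratedFDeriv_stdOrthonormalBasis]
  exact continuous_finsetSum _ fun i _ => (hf.continuous_iteratedFDeriv le_rfl).eval_const _

theorem hasGradientAt_comp_affine [CompleteSpace E] {f : E → ℝ} {g x a : E} {L : E →L[ℝ] E}
    (hf : HasGradientAt f g (L (x - a))) :
    HasGradientAt (fun z => f (L (z - a))) (ContinuousLinearMap.adjoint L g) x := by
  rw [hasGradientAt_iff_hasFDerivAt] at hf ⊢
  have haffine : HasFDerivAt (fun z => L (z - a)) L x :=
    L.hasFDerivAt.comp x ((hasFDerivAt_id x).sub_const a)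
  refine (hf.comp x haffine).congr_fderiv ?_
  ext v
  simp [ContinuousLinearMap.adjoint_inner_left]

theorem divergence_eq_trace {d : ℕ} {b : Space d → Space d} {x : Space d}
    {L : Space d →L[ℝ] Space d} (hb : HasFDerivAt b L x) :
    divergence b x = LinearMap.trace ℝ (Space d) L := by
  rw [divergence, hb.fderiv, LinearMap.trace_eq_sum_inner _ (EuclideanSpace.basisFun (Fin d) ℝ)]
  simp [EuclideanSpace.inner_single_left]

end Operators

namespace MovingMesh

variable {d : ℕ} {T : ℝ} {M : MovingMesh d T} {s : Finset (Space d)} {t : ℝ}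

namespace CellChart

variable (C : M.CellChart s)

theorem velocity_map (hT : 0 < T) (ht : t ∈ Icc 0 T) {Y : Space d} (hY : Y ∈ refCell s) :
    M.velocity t (C.map t Y) = C.linDeriv t Y + C.shiftDeriv t := by
  have hmap : HasDerivWithinAt (fun τ => C.map τ Y) (C.linDeriv t Y + C.shiftDeriv t)
      (Icc 0 T) t :=
    ((ContinuousLinearMap.apply ℝ (Space d) Y).hasFDerivAt.comp_hasDerivWithinAt t
      (C.hasDerivWithinAt_lin ht)).add (C.hasDerivWithinAt_shift ht)
  rw [velocity, C.aleInv_map ht hY]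
  exact (hmap.congr (fun τ hτ => C.ale_eq τ hτ Y hY) (C.ale_eq t ht Y hY)).derivWithin
    (uniqueDiffOn_Icc hT t ht)

theorem velocity_eq_affine (hT : 0 < T) (ht : t ∈ Icc 0 T) {x : Space d} (hx : x ∈ M.cell s t) :
    M.velocity t x
      = (C.linDeriv t * C.linInv t : Space d →L[ℝ] Space d) (x - C.shift t) + C.shiftDeriv t := by
  rw [C.cell_eq_image ht] at hx
  obtain ⟨Y, hY, rfl⟩ := hx
  rw [C.velocity_map hT ht hY]
  simp [map, C.linInv_lin_apply ht]

theorem hasFDerivAt_velocity (hT : 0 < T) (ht : t ∈ Icc 0 T) {x : Space d}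
    (hx : x ∈ interior (M.cell s t)) :
    HasFDerivAt (M.velocity t) (C.linDeriv t * C.linInv t) x :=
  (((C.linDeriv t * C.linInv t).hasFDerivAt.comp x ((hasFDerivAt_id x).sub_const
    (C.shift t))).add_const (C.shiftDeriv t)).congr_of_eventuallyEq
      (EqOn.eventuallyEq_of_mem (fun _ hz => C.velocity_eq_affine hT ht hz)
        (mem_interior_iff_mem_nhds.1 hx))

end CellChart

theorem exists_lipschitzOnWith_velocity (hT : 0 < T) (ht : t ∈ Icc 0 T) (hs : s ∈ M.cells) :
    ∃ L, LipschitzOnWith L (M.velocity t) (M.cell s t) := by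
  obtain ⟨C⟩ := nonempty_cellChart hs
  let B : Space d →L[ℝ] Space d := C.linDeriv t * C.linInv t
  refine ⟨‖B‖₊, fun x hx y hy => ?_⟩
  rw [C.velocity_eq_affine hT ht hx, C.velocity_eq_affine hT ht hy, edist_add_right]
  exact (B.lipschitz _ _).trans_eq (by rw [edist_sub_right])

theorem continuousOn_velocity (hT : 0 < T) (ht : t ∈ Icc 0 T) :
    ContinuousOn (M.velocity t) (M.domain t) := by
  rw [domain_eq_biUnion_cell, ← Finset.set_biUnion_coe, biUnion_eq_iUnion]
  refine (locallyFinite_of_finite _).continuousOn_iUnion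
    (fun s => (isCompact_cell s.2 ht).isClosed) fun s => ?_
  obtain ⟨L, hL⟩ := exists_lipschitzOnWith_velocity hT ht s.2
  exact hL.continuousOn

theorem memLp_cell_of_eqOn_interior {F : Type*} [NormedAddCommGroup F] (hs : s ∈ M.cells)
    (ht : t ∈ Icc 0 T) {g h : Space d → F} (hh : ContinuousOn h (M.cell s t))
    (hgh : EqOn g h (interior (M.cell s t))) (p : ENNReal) :
    MemLp g p (volume.restrict (M.cell s t)) :=
  (memLp_of_continuousOn_of_isCompact (isCompact_cell hs ht) hh p).ae_eq
    ((ae_mem_interior_cell hs ht).mono fun _ hx => (hgh hx).symm)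

namespace IsFE

variable {k : ℕ} {v : Space d → ℝ}

theorem exists_mem_polynomialSpace (hv : M.IsFE k t v) (hs : s ∈ M.cells) :
    ∃ P ∈ polynomialSpace d k, EqOn v P (M.cell s t) := by
  obtain ⟨p, hp, hvp⟩ := hv.polynomial s hs
  exact ⟨_, mem_polynomialSpace.2 ⟨p, hp, fun _ => rfl⟩, hvp⟩

theorem exists_contDiff (hv : M.IsFE k t v) (hs : s ∈ M.cells) :
    ∃ P : Space d → ℝ, ContDiff ℝ 2 P ∧ EqOn v P (M.cell s t) ∧
      ∀ x ∈ interior (M.cell s t), v =ᶠ[nhds x] P := by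
  obtain ⟨P, hP, hvP⟩ := hv.exists_mem_polynomialSpace hs
  exact ⟨P, contDiff_of_mem_polynomialSpace hP, hvP,
    fun x hx => hvP.eventuallyEq_of_mem (mem_interior_iff_mem_nhds.1 hx)⟩

theorem exists_lipschitzOnWith (hv : M.IsFE k t v) (hs : s ∈ M.cells) (ht : t ∈ Icc 0 T) :
    ∃ L, LipschitzOnWith L v (M.cell s t) := by
  obtain ⟨P, hP, hvP, -⟩ := hv.exists_contDiff hs
  obtain ⟨L, hL⟩ := ((hP.of_le one_le_two).locallyLipschitz.locallyLipschitzOn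
    (s := M.cell s t)).exists_lipschitzOnWith_of_compact (isCompact_cell hs ht)
  exact ⟨L, fun x hx y hy => by rw [hvP hx, hvP hy]; exact hL hx hy⟩

theorem differentiableAt (hv : M.IsFE k t v) (hs : s ∈ M.cells) {x : Space d}
    (hx : x ∈ interior (M.cell s t)) : DifferentiableAt ℝ v x := by
  obtain ⟨P, hP, -, hvP⟩ := hv.exists_contDiff hs
  exact (hP.differentiable two_ne_zero x).congr_of_eventuallyEq (hvP x hx)

theorem memLp (hv : M.IsFE k t v) (hs : s ∈ M.cells) (ht : t ∈ Icc 0 T) (p : ENNReal) :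
    MemLp v p (volume.restrict (M.cell s t)) :=
  memLp_of_continuousOn_of_isCompact (isCompact_cell hs ht)
    (hv.continuousOn.mono (cell_subset_domain hs t)) p

theorem memLp_gradient (hv : M.IsFE k t v) (hs : s ∈ M.cells) (ht : t ∈ Icc 0 T) (p : ENNReal) :
    MemLp (gradient v) p (volume.restrict (M.cell s t)) := by
  obtain ⟨P, hP, -, hvP⟩ := hv.exists_contDiff hs
  exact memLp_cell_of_eqOn_interior hs ht
    (continuous_gradient_of_contDiff (hP.of_le one_le_two)).continuousOn
    (fun x hx => (hvP x hx).gradient_eq) p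

theorem memLp_laplacian (hv : M.IsFE k t v) (hs : s ∈ M.cells) (ht : t ∈ Icc 0 T) (p : ENNReal) :
    MemLp (Laplacian.laplacian v) p (volume.restrict (M.cell s t)) := by
  obtain ⟨P, hP, -, hvP⟩ := hv.exists_contDiff hs
  exact memLp_cell_of_eqOn_interior hs ht (continuous_laplacian_of_contDiff hP).continuousOn
    (fun x hx => (InnerProductSpace.laplacian_congr_nhds (hvP x hx)).self_of_nhds) p

theorem memLp_convect (hT : 0 < T) (hv : M.IsFE k t v) (hs : s ∈ M.cells) (ht : t ∈ Icc 0 T)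
    {D : Data d} (hb : ContinuousOn (D.b t) (M.domain t)) (p : ENNReal) :
    MemLp (convect M D t v) p (volume.restrict (M.cell s t)) := by
  obtain ⟨P, hP, -, hvP⟩ := hv.exists_contDiff hs
  have hβ : ContinuousOn (fun x => D.b t x - M.velocity t x) (M.cell s t) :=
    (hb.sub (continuousOn_velocity hT ht)).mono (cell_subset_domain hs t)
  refine memLp_cell_of_eqOn_interior hs ht (hβ.inner
    (continuous_gradient_of_contDiff (hP.of_le one_le_two)).continuousOn) (fun x hx => ?_) p
  rw [convect, (hvP x hx).gradient_eq]

end IsFE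

end MovingMesh

/-! ### Integration by parts -/

section LineDeriv

variable {E : Type*} [NormedAddCommGroup E] [NormedSpace ℝ E] [FiniteDimensional ℝ E]
  [MeasurableSpace E] [BorelSpace E] (μ : Measure E) [μ.IsAddHaarMeasure] {f : E → ℝ} {L : ℝ≥0}

theorem integrable_lineDeriv (hf : LipschitzWith L f)
    (hc : HasCompactSupport f) (v : E) : Integrable (fun x => lineDeriv ℝ f x v) μ := by
  have hsupp : (fun x => lineDeriv ℝ f x v).support ⊆ tsupport f := fun x hx => by
    by_contra hxf
    have hzero := (notMem_tsupport_iff_eventuallyEq.1 hxf).lineDeriv_eq (𝕜 := ℝ) (v := v)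
    exact hx (hzero.trans (by simp [lineDeriv]))
  rw [← integrableOn_iff_integrable_of_support_subset hsupp]
  exact (hf.locallyIntegrable_lineDeriv v).integrableOn_isCompact hc

theorem integral_lineDeriv_eq_zero (hf : LipschitzWith L f)
    (hc : HasCompactSupport f) (v : E) : ∫ x, lineDeriv ℝ f x v ∂μ = 0 := by
  have hparts := (LipschitzWith.const (1 : ℝ)).integral_lineDeriv_mul_eq (μ := μ) hf hc (-v)
  simpa [lineDeriv] using hparts.symm

end LineDeriv

section Divergence

variable {d : ℕ}

theorem divergence_smul {g : Space d → ℝ} {β : Space d → Space d} {x : Space d}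
    (hg : DifferentiableAt ℝ g x) (hβ : DifferentiableAt ℝ β x) :
    divergence (fun y => g y • β y) x = g x * divergence β x + inner ℝ (β x) (gradient g x) := by
  have hβx : β x = ∑ i, β x i • EuclideanSpace.single i (1 : ℝ) := by
    simpa using ((EuclideanSpace.basisFun (Fin d) ℝ).sum_repr (β x)).symm
  rw [inner_gradient_right, starRingEnd_apply, star_trivial]
  conv_rhs => rw [hβx, map_sum]
  simp only [divergence, fderiv_fun_smul hg hβ, Finset.mul_sum, ← Finset.sum_add_distrib]
  refine Finset.sum_congr rfl fun i _ => ?_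
  simp [mul_comm]

variable {q : Space d → Space d} {L : ℝ≥0}

theorem divergence_ae_eq_sum_lineDeriv (hq : LipschitzWith L q) :
    divergence q =ᵐ[volume]
      fun x => ∑ i, lineDeriv ℝ (fun y => q y i) x (EuclideanSpace.single i 1) := by
  filter_upwards [hq.ae_differentiableAt] with x hx
  refine Finset.sum_congr rfl fun i _ => ?_
  exact (((EuclideanSpace.proj i : Space d →L[ℝ] ℝ).hasFDerivAt.comp x
    hx.hasFDerivAt).hasLineDerivAt _).lineDeriv.symm

theorem lipschitzWith_coord (hq : LipschitzWith L q) (i : Fin d) :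
    LipschitzWith L fun x => q x i :=
  (((LipschitzWith.eval i).comp (PiLp.lipschitzWith_ofLp 2 _)).comp hq).weaken (by simp)

theorem integrable_divergence (hq : LipschitzWith L q) (hc : HasCompactSupport q) :
    Integrable (divergence q) :=
  (integrable_finsetSum _ fun i _ => integrable_lineDeriv volume (lipschitzWith_coord hq i)
    (hc.comp_left (g := fun y : Space d => y i) rfl) _).congr
      (divergence_ae_eq_sum_lineDeriv hq).symm

theorem integral_divergence_eq_zero (hq : LipschitzWith L q) (hc : HasCompactSupport q) :
    ∫ x, divergence q x = 0 := by
  have hcoord (i : Fin d) : HasCompactSupport fun x => q x i :=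
    hc.comp_left (g := fun y : Space d => y i) rfl
  rw [integral_congr_ae (divergence_ae_eq_sum_lineDeriv hq), integral_finsetSum _ fun i _ =>
    integrable_lineDeriv volume (lipschitzWith_coord hq i) (hcoord i) _]
  exact Finset.sum_eq_zero fun i _ =>
    integral_lineDeriv_eq_zero volume (lipschitzWith_coord hq i) (hcoord i) _

end Divergence

namespace MovingMesh

variable {d : ℕ} {T : ℝ} {M : MovingMesh d T} {s : Finset (Space d)} {t : ℝ} {k : ℕ}

theorem exists_lipschitzWith_indicator_domain {F : Type*} [NormedAddCommGroup F]
    (ht : t ∈ Icc 0 T) {g : Space d → F} (hg : ContinuousOn g (M.domain t))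
    (hfr : ∀ x ∈ frontier (M.domain t), g x = 0)
    (hL : ∀ s ∈ M.cells, ∃ L, LipschitzOnWith L g (M.cell s t)) :
    ∃ L, LipschitzWith L ((M.domain t).indicator g) :=
  exists_lipschitzWith_indicator (isCompact_domain ht).isClosed
    (S := fun s : M.cells => M.cell s t) (fun s => (isCompact_cell s.2 ht).isClosed)
    (by rw [domain_eq_biUnion_cell, iUnion_subtype]) hg hfr fun s => hL s s.2

namespace IsFE

variable {v : Space d → ℝ} {β : Space d → Space d}

theorem integrableOn_inner_gradient_mul (hv : M.IsFE k t v) (ht : t ∈ Icc 0 T)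
    (hβ : ContinuousOn β (M.domain t)) :
    IntegrableOn (fun x => inner ℝ (β x) (gradient v x) * v x) (M.domain t) := by
  refine (integrableOn_domain_iff ht).2 fun s hs => ?_
  obtain ⟨P, hP, hvP, hnear⟩ := hv.exists_contDiff hs
  have hcont : ContinuousOn (fun x => inner ℝ (β x) (gradient P x) * P x) (M.cell s t) :=
    ((hβ.mono (cell_subset_domain hs t)).inner (continuous_gradient_of_contDiff
      (hP.of_le one_le_two)).continuousOn).mul hP.continuous.continuousOn
  exact memLp_one_iff_integrable.1 (memLp_cell_of_eqOn_interior hs ht hcont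
    (fun x hx => by simp only [(hnear x hx).gradient_eq, hvP (interior_subset hx)]) 1)

theorem exists_lipschitzWith_sq_smul (hv : M.IsFE k t v) (ht : t ∈ Icc 0 T)
    (hβ : ContinuousOn β (M.domain t))
    (hL : ∀ s ∈ M.cells, ∃ L, LipschitzOnWith L β (M.cell s t)) :
    ∃ L, LipschitzWith L ((M.domain t).indicator fun x => v x • v x • β x) := by
  refine exists_lipschitzWith_indicator_domain ht
    (hv.continuousOn.smul (hv.continuousOn.smul hβ))
    (fun x hx => by rw [hv.boundary x hx, zero_smul]) fun s hs => ?_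
  obtain ⟨Lβ, hLβ⟩ := hL s hs
  obtain ⟨Lv, hLv⟩ := hv.exists_lipschitzOnWith hs ht
  obtain ⟨L, hL⟩ := exists_lipschitzOnWith_smul (isCompact_cell hs ht) hLv hLβ
  exact exists_lipschitzOnWith_smul (isCompact_cell hs ht) hLv hL

theorem divergence_indicator_sq_smul_ae_eq (hv : M.IsFE k t v) (ht : t ∈ Icc 0 T)
    (hL : ∀ s ∈ M.cells, ∃ L, LipschitzOnWith L β (M.cell s t)) :
    ∀ᵐ x ∂volume.restrict (M.domain t),
      divergence ((M.domain t).indicator fun x => v x • v x • β x) x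
        = divergence β x * v x ^ 2 + 2 * (inner ℝ (β x) (gradient v x) * v x) := by
  refine (ae_domain_iff ht).2 fun s hs => ?_
  obtain ⟨L, hL⟩ := hL s hs
  filter_upwards [ae_mem_interior_cell hs ht,
    hL.ae_differentiableWithinAt (isCompact_cell hs ht).measurableSet] with x hx hβ
  have hcell : M.cell s t ∈ nhds x := mem_interior_iff_mem_nhds.1 hx
  have hβx : DifferentiableAt ℝ β x := hβ.differentiableAt hcell
  have hvx : DifferentiableAt ℝ v x := hv.differentiableAt hs hx
  have hind : (M.domain t).indicator (fun x => v x • v x • β x)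
      =ᶠ[nhds x] fun x => v x • v x • β x :=
    Filter.mem_of_superset hcell fun y hy => indicator_of_mem (cell_subset_domain hs t hy) _
  rw [divergence, hind.fderiv_eq, ← divergence, divergence_smul hvx (hvx.fun_smul hβx),
    divergence_smul hvx hβx, real_inner_smul_left]
  ring

/- The field `v² β` vanishes on the boundary, so its extension by zero is Lipschitz and has
divergence of mean zero. -/
theorem integral_divergence_mul_sq (hv : M.IsFE k t v) (ht : t ∈ Icc 0 T)
    (hβ : ContinuousOn β (M.domain t))
    (hL : ∀ s ∈ M.cells, ∃ L, LipschitzOnWith L β (M.cell s t)) :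
    IntegrableOn (fun x => divergence β x * v x ^ 2) (M.domain t) ∧
      ∫ x in M.domain t, divergence β x * v x ^ 2
        = -2 * ∫ x in M.domain t, inner ℝ (β x) (gradient v x) * v x := by
  obtain ⟨L, hq⟩ := hv.exists_lipschitzWith_sq_smul ht hβ hL
  have hdiv := hv.divergence_indicator_sq_smul_ae_eq ht hL
  set q := (M.domain t).indicator fun x => v x • v x • β x
  have hc : HasCompactSupport q := .intro (isCompact_domain ht) fun x hx => indicator_of_notMem hx _
  have hgrad := (hv.integrableOn_inner_gradient_mul ht hβ).const_mul 2
  have hint : IntegrableOn (fun x => divergence β x * v x ^ 2) (M.domain t) :=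
    ((integrable_divergence hq hc).integrableOn.sub hgrad).congr
      (hdiv.mono fun x hx => by simp only [Pi.sub_apply, hx, add_sub_cancel_right])
  refine ⟨hint, ?_⟩
  have hoff (x : Space d) (hx : x ∉ M.domain t) : divergence q x = 0 := by
    have hzero : q =ᶠ[nhds x] 0 :=
      Filter.mem_of_superset ((isCompact_domain ht).isClosed.isOpen_compl.mem_nhds hx)
        fun y hy => indicator_of_notMem hy _
    simp [divergence, hzero.fderiv_eq]
  have hsum := setIntegral_eq_integral_of_forall_compl_eq_zero (μ := volume) hoff
  rw [integral_divergence_eq_zero hq hc, integral_congr_ae hdiv, integral_add hint hgrad,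
    integral_const_mul] at hsum
  linarith

end IsFE

end MovingMesh

/-! ### Moving finite element functions -/

section

variable {d : ℕ} {T : ℝ} {M : MovingMesh d T} {s : Finset (Space d)} {t : ℝ} {k : ℕ}
  {u : ℝ → Space d → ℝ}

namespace MovingMesh

theorem normSq_domain (ht : t ∈ Icc 0 T) {F : Type*} [NormedAddCommGroup F] {g : Space d → F}
    (hg : ∀ s ∈ M.cells, MemLp g 2 (volume.restrict (M.cell s t))) :
    normSq (M.domain t) g = ∑ s ∈ M.cells, normSq (M.cell s t) g :=
  integral_domain ht fun s hs => (hg s hs).integrable_norm_pow two_ne_zero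

theorem CellChart.continuousOn_integral_cell (C : M.CellChart s) {g h : ℝ → Space d → ℝ}
    (hh : ContinuousOn (fun p : ℝ × Space d => h p.1 p.2) (Icc 0 T ×ˢ refCell s))
    (hgh : ∀ t ∈ Icc 0 T, ∀ Y ∈ interior (refCell s), g t (C.map t Y) = h t Y) :
    ContinuousOn (fun t => ∫ x in M.cell s t, g t x) (Icc 0 T) :=
  (C.continuousOn_det_lin.abs.mul (continuousOn_integral_of_isCompact (μ := volume) isCompact_Icc
    (isCompact_refCell s) hh)).congr fun t ht => C.integral_cell_of_eqOn_interior ht (hgh t ht)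

theorem CellChart.map_mem_interior_cell (C : M.CellChart s) (ht : t ∈ Icc 0 T) {Y : Space d}
    (hY : Y ∈ interior (refCell s)) : C.map t Y ∈ interior (M.cell s t) :=
  C.interior_cell ht ▸ mem_image_of_mem _ hY

/-- A function of time with values in the moving finite element space whose values along the
trajectories of the ALE map are continuous, and differentiable at positive times. -/
structure IsMovingFE (M : MovingMesh d T) (k : ℕ) (u : ℝ → Space d → ℝ) : Prop where
  isFE : ∀ t ∈ Icc 0 T, M.IsFE k t (u t)
  continuousOn : ∀ Y ∈ M.ref.space, ContinuousOn (fun t => u t (M.ale t Y)) (Icc 0 T)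
  differentiableOn : ∀ Y ∈ M.ref.space, ∀ t ∈ Ioc 0 T,
    DifferentiableWithinAt ℝ (fun τ => u τ (M.ale τ Y)) (Icc 0 T) t

/-- Nodes and polynomial shape functions on the reference cell `s` through which `u` is
interpolated exactly at all times, so that only the nodal values depend on time. -/
structure NodalForm (M : MovingMesh d T) (k : ℕ) (u : ℝ → Space d → ℝ)
    (s : Finset (Space d)) where
  card : ℕ
  node : Fin card → Space d
  shape : Fin card → Space d → ℝ
  node_mem : ∀ i, node i ∈ refCell s
  shape_mem : ∀ i, shape i ∈ polynomialSpace d k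
  interpolation : ∀ t ∈ Icc 0 T, ∀ Y ∈ refCell s,
    u t (M.ale t Y) = ∑ i, u t (M.ale t (node i)) * shape i Y

theorem IsMovingFE.nonempty_nodalForm (hu : M.IsMovingFE k u) (hs : s ∈ M.cells) :
    Nonempty (M.NodalForm k u s) := by
  obtain ⟨C⟩ := nonempty_cellChart hs
  obtain ⟨n, Y, φ, hY, hφ⟩ := exists_nodal_representation (polynomialSpace d k) (refCell s)
  refine ⟨⟨n, Y, fun i => φ i, hY, fun i => (φ i).2, fun t ht y hy => ?_⟩⟩
  obtain ⟨P, hP, huP⟩ := (hu.isFE t ht).exists_mem_polynomialSpace hs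
  have hpull (z : Space d) (hz : z ∈ refCell s) :
      u t (M.ale t z) = P (C.lin t z + C.shift t) := by
    rw [huP (mem_image_of_mem _ hz), C.ale_eq t ht z hz]
  rw [hpull y hy, hφ _ (comp_affine_mem_polynomialSpace hP (C.lin t) (C.shift t)) y hy]
  exact Finset.sum_congr rfl fun i _ => by rw [hpull _ (hY i)]

namespace NodalForm

variable (N : M.NodalForm k u s) (C : M.CellChart s)

/-- The nodal values. -/
def coeff (t : ℝ) (i : Fin N.card) : ℝ := u t (M.ale t (N.node i))

/-- The time derivatives of the nodal values. -/
noncomputable def coeffDeriv (t : ℝ) (i : Fin N.card) : ℝ :=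
  derivWithin (fun τ => N.coeff τ i) (Icc 0 T) t

/-- The gradient of `u` pulled back to the reference cell by the chart `C`. -/
noncomputable def refGradient (t : ℝ) (Y : Space d) : Space d :=
  ContinuousLinearMap.adjoint (C.linInv t) (∑ i, N.coeff t i • gradient (N.shape i) Y)

theorem contDiff_shape (i : Fin N.card) : ContDiff ℝ 2 (N.shape i) :=
  contDiff_of_mem_polynomialSpace (N.shape_mem i)

theorem memLp_shape (i : Fin N.card) :
    MemLp (N.shape i) 2 (volume.restrict (refCell s)) :=
  memLp_of_continuousOn_of_isCompact (isCompact_refCell s)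
    (N.contDiff_shape i).continuous.continuousOn 2

theorem continuousOn_coeff (hu : M.IsMovingFE k u) (hs : s ∈ M.cells) (i : Fin N.card) :
    ContinuousOn (fun t => N.coeff t i) (Icc 0 T) :=
  hu.continuousOn _ (refCell_subset_space hs (N.node_mem i))

theorem hasDerivWithinAt_coeff (hu : M.IsMovingFE k u) (hs : s ∈ M.cells) (ht : t ∈ Ioc 0 T)
    (i : Fin N.card) :
    HasDerivWithinAt (fun t => N.coeff t i) (N.coeffDeriv t i) (Icc 0 T) t :=
  (hu.differentiableOn _ (refCell_subset_space hs (N.node_mem i)) t ht).hasDerivWithinAt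

theorem apply_map (ht : t ∈ Icc 0 T) {Y : Space d} (hY : Y ∈ refCell s) :
    u t (C.map t Y) = ∑ i, N.coeff t i * N.shape i Y := by
  rw [CellChart.map, ← C.ale_eq t ht Y hY]
  exact N.interpolation t ht Y hY

theorem gradient_map (ht : t ∈ Icc 0 T) {Y : Space d} (hY : Y ∈ interior (refCell s)) :
    gradient (u t) (C.map t Y) = N.refGradient C t Y := by
  have hlinInv (Z : Space d) : C.linInv t (C.map t Z - C.shift t) = Z := by
    simp only [CellChart.map, add_sub_cancel_right, C.linInv_lin_apply ht]
  have hshape : HasGradientAt (fun y => ∑ i, N.coeff t i * N.shape i y)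
      (∑ i, N.coeff t i • gradient (N.shape i) Y) (C.linInv t (C.map t Y - C.shift t)) := by
    rw [hlinInv, hasGradientAt_iff_hasFDerivAt, map_sum]
    refine HasFDerivAt.fun_sum fun i _ => ?_
    rw [map_smul]
    exact ((N.contDiff_shape i).differentiable two_ne_zero Y).hasGradientAt.hasFDerivAt.const_mul _
  refine ((hasGradientAt_comp_affine hshape).congr_of_eventuallyEq ?_).gradient
  filter_upwards [mem_interior_iff_mem_nhds.1 (C.map_mem_interior_cell ht hY)] with x hx
  rw [C.cell_eq_image ht] at hx
  obtain ⟨Z, hZ, rfl⟩ := hx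
  rw [hlinInv, N.apply_map C ht hZ]

theorem aleDeriv_map (hu : M.IsMovingFE k u) (hT : 0 < T) (ht : t ∈ Ioc 0 T) {Y : Space d}
    (hY : Y ∈ refCell s) :
    M.aleDeriv u t (C.map t Y) = ∑ i, N.coeffDeriv t i * N.shape i Y := by
  have ht' : t ∈ Icc 0 T := Ioc_subset_Icc_self ht
  have hsum : HasDerivWithinAt (fun τ => ∑ i, N.coeff τ i * N.shape i Y)
      (∑ i, N.coeffDeriv t i * N.shape i Y) (Icc 0 T) t :=
    HasDerivWithinAt.fun_sum fun i _ =>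
      (N.hasDerivWithinAt_coeff hu C.mem_cells ht i).mul_const _
  rw [aleDeriv, C.aleInv_map ht' hY]
  exact (hsum.congr (fun τ hτ => N.interpolation τ hτ Y hY)
    (N.interpolation t ht' Y hY)).derivWithin (uniqueDiffOn_Icc hT t ht')

theorem continuousOn_apply (hu : M.IsMovingFE k u) (hs : s ∈ M.cells) :
    ContinuousOn (fun p : ℝ × Space d => ∑ i, N.coeff p.1 i * N.shape i p.2)
      (Icc 0 T ×ˢ refCell s) :=
  continuousOn_finsetSum _ fun i _ =>
    ((N.continuousOn_coeff hu hs i).comp continuousOn_fst fun _ hp => hp.1).mul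
      ((N.contDiff_shape i).continuous.comp continuous_snd).continuousOn

theorem continuousOn_refGradient (hu : M.IsMovingFE k u) :
    ContinuousOn (fun p : ℝ × Space d => N.refGradient C p.1 p.2) (Icc 0 T ×ˢ refCell s) := by
  refine ContinuousOn.clm_apply ?_ (continuousOn_finsetSum _ fun i _ => ContinuousOn.fun_smul ?_ ?_)
  · exact (ContinuousLinearMap.adjoint (𝕜 := ℝ) (E := Space d) (F := Space d)).continuous
      |>.comp_continuousOn (C.continuousOn_linInv.comp continuousOn_fst fun _ hp => hp.1)
  · exact (N.continuousOn_coeff hu C.mem_cells i).comp continuousOn_fst fun _ hp => hp.1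
  · exact ((continuous_gradient_of_contDiff ((N.contDiff_shape i).of_le one_le_two)).comp
      continuous_snd).continuousOn

theorem normSq_cell_eq (ht : t ∈ Icc 0 T) :
    normSq (M.cell s t) (u t)
      = |(C.lin t).det| * ∫ Y in refCell s, (∑ i, N.coeff t i * N.shape i Y) ^ 2 :=
  C.integral_cell_of_eqOn_interior ht fun Y hY => by
    rw [N.apply_map C ht (interior_subset hY), Real.norm_eq_abs, sq_abs]

theorem integral_divergence_velocity_mul_sq (hT : 0 < T) (ht : t ∈ Icc 0 T) :
    ∫ x in M.cell s t, divergence (M.velocity t) x * u t x ^ 2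
      = |(C.lin t).det| *
        (LinearMap.trace ℝ (Space d) (C.linDeriv t * C.linInv t : Space d →L[ℝ] Space d)
          * ∫ Y in refCell s, (∑ i, N.coeff t i * N.shape i Y) ^ 2) := by
  rw [← integral_const_mul]
  exact C.integral_cell_of_eqOn_interior ht fun Y hY => by
    rw [divergence_eq_trace (C.hasFDerivAt_velocity hT ht (C.map_mem_interior_cell ht hY)),
      N.apply_map C ht (interior_subset hY)]

theorem integral_aleDeriv_mul (hu : M.IsMovingFE k u) (hT : 0 < T) (ht : t ∈ Ioc 0 T) :
    ∫ x in M.cell s t, M.aleDeriv u t x * u t x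
      = |(C.lin t).det| * ∫ Y in refCell s, (∑ i, N.coeffDeriv t i * N.shape i Y)
          * ∑ i, N.coeff t i * N.shape i Y :=
  have ht' : t ∈ Icc 0 T := Ioc_subset_Icc_self ht
  C.integral_cell_of_eqOn_interior ht' fun Y hY => by
    rw [N.apply_map C ht' (interior_subset hY), N.aleDeriv_map C hu hT ht (interior_subset hY)]

end NodalForm

namespace IsMovingFE

theorem memLp_aleDeriv (hu : M.IsMovingFE k u) (hT : 0 < T) (ht : t ∈ Ioc 0 T) (hs : s ∈ M.cells)
    (p : ENNReal) : MemLp (M.aleDeriv u t) p (volume.restrict (M.cell s t)) := by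
  have ht' : t ∈ Icc 0 T := Ioc_subset_Icc_self ht
  obtain ⟨C⟩ := nonempty_cellChart hs
  obtain ⟨N⟩ := hu.nonempty_nodalForm hs
  have hcont : Continuous fun x =>
      ∑ i, N.coeffDeriv t i * N.shape i ((C.homeomorph ht').symm x) :=
    continuous_finsetSum _ fun i _ => continuous_const.mul
      ((N.contDiff_shape i).continuous.comp (C.homeomorph ht').symm.continuous)
  refine memLp_cell_of_eqOn_interior hs ht' hcont.continuousOn (fun x hx => ?_) p
  rw [C.interior_cell ht'] at hx
  obtain ⟨Y, hY, rfl⟩ := hx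
  have hsymm : (C.homeomorph ht').symm (C.map t Y) = Y := (C.homeomorph ht').symm_apply_apply Y
  simp only [N.aleDeriv_map C hu hT ht (interior_subset hY), hsymm]

theorem continuousOn_normSq_cell (hu : M.IsMovingFE k u) (hs : s ∈ M.cells) :
    ContinuousOn (fun t => normSq (M.cell s t) (u t)) (Icc 0 T) := by
  obtain ⟨C⟩ := nonempty_cellChart hs
  obtain ⟨N⟩ := hu.nonempty_nodalForm hs
  exact C.continuousOn_integral_cell ((N.continuousOn_apply hu hs).norm.pow 2)
    fun t ht Y hY => by rw [N.apply_map C ht (interior_subset hY)]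

theorem continuousOn_normSq_gradient_cell (hu : M.IsMovingFE k u) (hs : s ∈ M.cells) :
    ContinuousOn (fun t => normSq (M.cell s t) (gradient (u t))) (Icc 0 T) := by
  obtain ⟨C⟩ := nonempty_cellChart hs
  obtain ⟨N⟩ := hu.nonempty_nodalForm hs
  exact C.continuousOn_integral_cell ((N.continuousOn_refGradient C hu).norm.pow 2)
    fun t ht Y hY => by rw [N.gradient_map C ht hY]

theorem continuousOn_normSq_convect_cell (hu : M.IsMovingFE k u) (hT : 0 < T) (hs : s ∈ M.cells)
    {D : Data d} (hb : ContinuousOn (fun p : ℝ × Space d => D.b p.1 p.2) M.spaceTime) :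
    ContinuousOn (fun t => normSq (M.cell s t) (convect M D t (u t))) (Icc 0 T) := by
  obtain ⟨C⟩ := nonempty_cellChart hs
  obtain ⟨N⟩ := hu.nonempty_nodalForm hs
  have hmaps : MapsTo (fun p : ℝ × Space d => (p.1, C.map p.1 p.2)) (Icc 0 T ×ˢ refCell s)
      M.spaceTime := fun p hp =>
    ⟨hp.1, cell_subset_domain hs _ (by rw [C.cell_eq_image hp.1]; exact mem_image_of_mem _ hp.2)⟩
  have hb' : ContinuousOn (fun p : ℝ × Space d => D.b p.1 (C.map p.1 p.2))
      (Icc 0 T ×ˢ refCell s) :=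
    hb.comp (continuousOn_fst.prodMk
      (C.continuousOn_map.mono (prod_mono_right (subset_univ _)))) hmaps
  have hw : ContinuousOn (fun p : ℝ × Space d => C.linDeriv p.1 p.2 + C.shiftDeriv p.1)
      (Icc 0 T ×ˢ refCell s) :=
    (((C.continuousOn_linDeriv hT).comp continuousOn_fst fun _ hp => hp.1).clm_apply
      continuousOn_snd).add ((C.continuousOn_shiftDeriv hT).comp continuousOn_fst fun _ hp => hp.1)
  exact C.continuousOn_integral_cell (h := fun t Y => ‖inner ℝ (D.b t (C.map t Y)
      - (C.linDeriv t Y + C.shiftDeriv t)) (N.refGradient C t Y)‖ ^ 2)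
    (((hb'.fun_sub hw).inner (𝕜 := ℝ) (N.continuousOn_refGradient C hu)).norm.fun_pow 2)
    fun t ht Y hY => by
      simp only [convect, N.gradient_map C ht hY, C.velocity_map hT ht (interior_subset hY)]

theorem normSq_domain_eq_sum (hu : M.IsMovingFE k u) (ht : t ∈ Icc 0 T) :
    normSq (M.domain t) (u t) = ∑ s ∈ M.cells, normSq (M.cell s t) (u t) :=
  normSq_domain ht fun _ hs => (hu.isFE t ht).memLp hs ht 2

theorem continuousOn_normSq_domain (hu : M.IsMovingFE k u) :
    ContinuousOn (fun t => normSq (M.domain t) (u t)) (Icc 0 T) :=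
  (continuousOn_finsetSum _ fun _ hs => hu.continuousOn_normSq_cell hs).congr
    fun _ ht => hu.normSq_domain_eq_sum ht

theorem continuousOn_normSq_gradient_domain (hu : M.IsMovingFE k u) :
    ContinuousOn (fun t => normSq (M.domain t) (gradient (u t))) (Icc 0 T) :=
  (continuousOn_finsetSum _ fun _ hs => hu.continuousOn_normSq_gradient_cell hs).congr
    fun _ ht => normSq_domain ht fun _ hs => (hu.isFE _ ht).memLp_gradient hs ht 2

/-! ### Reynolds' transport theorem -/

theorem hasDerivWithinAt_normSq_cell (hu : M.IsMovingFE k u) (hT : 0 < T) (ht : t ∈ Ioc 0 T)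
    (hs : s ∈ M.cells) :
    HasDerivWithinAt (fun t => normSq (M.cell s t) (u t))
      ((∫ x in M.cell s t, divergence (M.velocity t) x * u t x ^ 2)
        + 2 * ∫ x in M.cell s t, M.aleDeriv u t x * u t x) (Icc 0 T) t := by
  have ht' : t ∈ Icc 0 T := Ioc_subset_Icc_self ht
  obtain ⟨C⟩ := nonempty_cellChart hs
  obtain ⟨N⟩ := hu.nonempty_nodalForm hs
  have hdet := (hasDerivAt_abs (C.det_lin_ne_zero ht')).comp_hasDerivWithinAt t
    (hasDerivWithinAt_det (C.hasDerivWithinAt_lin ht') (C.lin_mul_linInv ht')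
      (C.linInv_mul_lin ht'))
  have hsq := hasDerivWithinAt_integral_sum_sq N.memLp_shape
    fun i => N.hasDerivWithinAt_coeff hu hs ht i
  refine ((hdet.fun_mul hsq).congr (fun τ hτ => N.normSq_cell_eq C hτ)
    (N.normSq_cell_eq C ht')).congr_deriv ?_
  rw [N.integral_divergence_velocity_mul_sq C hT ht', N.integral_aleDeriv_mul C hu hT ht,
    ← sign_mul_self (C.lin t).det, Function.comp_apply, ← sign_mul_self (C.lin t).det]
  ring

/- The cellwise volume terms `∇ · w_h |u|²` combine to `-2 (w_h · ∇u, u)` by integration by parts,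
which is what cancels the mesh velocity in the energy balance. -/
theorem hasDerivWithinAt_normSq_domain (hu : M.IsMovingFE k u) (hT : 0 < T) (ht : t ∈ Ioc 0 T) :
    HasDerivWithinAt (fun t => normSq (M.domain t) (u t))
      (2 * (∫ x in M.domain t, M.aleDeriv u t x * u t x)
        - 2 * ∫ x in M.domain t, inner ℝ (M.velocity t x) (gradient (u t) x) * u t x)
      (Icc 0 T) t := by
  have ht' : t ∈ Icc 0 T := Ioc_subset_Icc_self ht
  have hv := hu.isFE t ht'
  obtain ⟨hdiv, hparts⟩ := hv.integral_divergence_mul_sq ht' (continuousOn_velocity hT ht')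
    fun s hs => exists_lipschitzOnWith_velocity hT ht' hs
  have hcells := HasDerivWithinAt.fun_sum fun s hs => hu.hasDerivWithinAt_normSq_cell hT ht
    (s := s) hs
  refine (hcells.congr (fun τ hτ => hu.normSq_domain_eq_sum hτ)
    (hu.normSq_domain_eq_sum ht')).congr_deriv ?_
  rw [Finset.sum_add_distrib, ← Finset.mul_sum,
    ← integral_domain ht' fun s hs => (integrableOn_domain_iff ht').1 hdiv s hs,
    ← integral_domain (g := fun x => M.aleDeriv u t x * u t x) ht' fun s hs =>
      (hu.memLp_aleDeriv hT ht hs 2).integrable_mul (hv.memLp hs ht' 2), hparts]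
  ring

end IsMovingFE

end MovingMesh

end

/-! ### The energy inequality -/

section

section Norms

variable {d : ℕ} {S : Set (Space d)}

theorem normSq_eq_integral_sq (S : Set (Space d)) (g : Space d → ℝ) :
    normSq S g = ∫ x in S, g x ^ 2 := by
  simp only [normSq, Real.norm_eq_abs, sq_abs]

theorem normSq_nonneg {F : Type*} [NormedAddCommGroup F] (S : Set (Space d)) (g : Space d → F) :
    0 ≤ normSq S g :=
  integral_nonneg fun _ => sq_nonneg _

theorem normSq_const_mul (S : Set (Space d)) (a : ℝ) (g : Space d → ℝ) :
    normSq S (fun x => a * g x) = a ^ 2 * normSq S g := by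
  simp only [normSq_eq_integral_sq, mul_pow, integral_const_mul]

theorem ae_abs_le_supNorm {c : Space d → ℝ} (hc : MemLp c ⊤ (volume.restrict S)) :
    ∀ᵐ x ∂volume.restrict S, |c x| ≤ supNorm S c := by
  filter_upwards [ae_le_eLpNormEssSup (f := c) (μ := volume.restrict S)] with x hx
  rw [← Real.norm_eq_abs, ← toReal_enorm]
  exact ENNReal.toReal_mono hc.eLpNorm_ne_top (eLpNorm_exponent_top (f := c) ▸ hx)

theorem normSq_mul_le {c v : Space d → ℝ} (hc : MemLp c ⊤ (volume.restrict S))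
    (hv : MemLp v 2 (volume.restrict S)) :
    normSq S (fun x => c x * v x) ≤ supNorm S c ^ 2 * normSq S v := by
  simp only [normSq_eq_integral_sq, ← integral_const_mul]
  refine integral_mono_ae (hv.mul' hc : MemLp (fun x => c x * v x) 2 _).integrable_sq
    (hv.integrable_sq.const_mul _) ?_
  filter_upwards [ae_abs_le_supNorm hc] with x hx
  rw [mul_pow, ← sq_abs (c x)]
  gcongr

theorem half_normSq_sub_normSq_le_integral {X Y Z : Space d → ℝ}
    (hX : MemLp X 2 (volume.restrict S)) (hY : MemLp Y 2 (volume.restrict S))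
    (hZ : MemLp Z 2 (volume.restrict S)) :
    1 / 2 * normSq S X - normSq S Y - normSq S Z ≤ ∫ x in S, (Y x + X x + Z x) * X x := by
  have hsplit : ∫ x in S, (Y x + X x + Z x) * X x
      = (∫ x in S, Y x * X x) + (∫ x in S, X x ^ 2) + ∫ x in S, Z x * X x := by
    have hYX : Integrable (fun x => Y x * X x) (volume.restrict S) := hY.integrable_mul hX
    have hZX : Integrable (fun x => Z x * X x) (volume.restrict S) := hZ.integrable_mul hX
    rw [← integral_add hYX hX.integrable_sq, ← integral_add (hYX.fun_add hX.integrable_sq) hZX]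
    exact integral_congr_ae (.of_forall fun x => by ring)
  have hYX := integral_mul_le_of_memLp_two hY.neg hX one_pos
  have hZX := integral_mul_le_of_memLp_two hZ.neg hX one_pos
  simp only [Pi.neg_apply, neg_mul, integral_neg, neg_sq] at hYX hZX
  simp only [normSq_eq_integral_sq]
  linarith

end Norms

variable {d : ℕ} {T : ℝ} {M : MovingMesh d T} {s : Finset (Space d)} {t : ℝ} {k : ℕ}
  {D : Data d} {μ c_inv : ℝ} {v : Space d → ℝ} {u : ℝ → Space d → ℝ}

theorem InverseInequality.normSq_laplacian_le (hinv : InverseInequality M k c_inv)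
    (hv : M.IsFE k t v) (ht : t ∈ Ioc 0 T) (hs : s ∈ M.cells) :
    normSq (M.cell s t) (Laplacian.laplacian v)
      ≤ (c_inv * (M.cellDiam s t)⁻¹) ^ 2 * normSq (M.cell s t) (gradient v) := by
  have hsq := pow_le_pow_left₀ (Real.sqrt_nonneg _) (hinv t ht v hv s hs) 2
  rwa [mul_pow, Real.sq_sqrt (normSq_nonneg _ _), Real.sq_sqrt (normSq_nonneg _ _)] at hsq

theorem InverseInequality.mul_normSq_laplacian_le (hinv : InverseInequality M k c_inv)
    (hc_inv : 0 < c_inv) (hv : M.IsFE k t v) (ht : t ∈ Ioc 0 T) (hs : s ∈ M.cells)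
    {ε δ : ℝ} (hε : 0 < ε) (hδ : 0 ≤ δ)
    (hδ₂ : δ ≤ M.cellDiam s t ^ 2 / (2 * ε * c_inv ^ 2)) :
    δ * (ε ^ 2 * normSq (M.cell s t) (Laplacian.laplacian v))
      ≤ ε / 2 * normSq (M.cell s t) (gradient v) := by
  set h := M.cellDiam s t
  have hfactor : δ * (ε ^ 2 * (c_inv * h⁻¹) ^ 2) ≤ ε / 2 := by
    rcases eq_or_ne h 0 with h0 | h0
    · simpa [h0] using (half_pos hε).le
    · calc δ * (ε ^ 2 * (c_inv * h⁻¹) ^ 2)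
          ≤ h ^ 2 / (2 * ε * c_inv ^ 2) * (ε ^ 2 * (c_inv * h⁻¹) ^ 2) := by gcongr
        _ = ε / 2 := by field_simp
  calc δ * (ε ^ 2 * normSq (M.cell s t) (Laplacian.laplacian v))
      ≤ δ * (ε ^ 2 * ((c_inv * h⁻¹) ^ 2 * normSq (M.cell s t) (gradient v))) := by
        gcongr
        exact hinv.normSq_laplacian_le hv ht hs
    _ = δ * (ε ^ 2 * (c_inv * h⁻¹) ^ 2) * normSq (M.cell s t) (gradient v) := by ring
    _ ≤ ε / 2 * normSq (M.cell s t) (gradient v) := by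
        gcongr
        exact normSq_nonneg _ _

namespace Data.IsRegular

theorem continuousOn_b (hD : D.IsRegular M) (ht : t ∈ Icc 0 T) :
    ContinuousOn (D.b t) (M.domain t) :=
  hD.b_continuousOn.comp (continuous_const.prodMk continuous_id).continuousOn
    fun _ hx => ⟨ht, hx⟩

theorem memLp_c (hD : D.IsRegular M) (ht : t ∈ Ioc 0 T) (hs : s ∈ M.cells) :
    MemLp (D.c t) ⊤ (volume.restrict (M.cell s t)) :=
  (hD.c_bounded t ht).mono_measure (Measure.restrict_mono_set _ (M.cell_subset_domain hs t))

theorem memLp_f (hD : D.IsRegular M) (ht : t ∈ Ioc 0 T) (hs : s ∈ M.cells) :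
    MemLp (D.f t) 2 (volume.restrict (M.cell s t)) :=
  (hD.f_memLp t ht).mono_measure (Measure.restrict_mono_set _ (M.cell_subset_domain hs t))

end Data.IsRegular

namespace MovingMesh.IsFE

theorem mul_normSq_le_convection_add_reaction (hv : M.IsFE k t v) (hD : D.IsRegular M)
    (ht : t ∈ Ioc 0 T)
    (hcoer : ∀ᵐ x ∂volume.restrict (M.domain t), μ ≤ D.c t x - 1 / 2 * divergence (D.b t) x) :
    μ * normSq (M.domain t) v
      ≤ (∫ x in M.domain t, inner ℝ (D.b t x) (gradient v x) * v x)
        + ∫ x in M.domain t, D.c t x * v x * v x := by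
  have ht' : t ∈ Icc 0 T := Ioc_subset_Icc_self ht
  obtain ⟨L, hL⟩ := hD.b_lipschitz t ht
  obtain ⟨hdiv, hparts⟩ := hv.integral_divergence_mul_sq ht' (hD.continuousOn_b ht')
    fun s hs => ⟨L, hL.mono (M.cell_subset_domain hs t)⟩
  have hsq : IntegrableOn (fun x => v x ^ 2) (M.domain t) :=
    (integrableOn_domain_iff ht').2 fun s hs => (hv.memLp hs ht' 2).integrable_sq
  have hreact : IntegrableOn (fun x => D.c t x * v x * v x) (M.domain t) :=
    (integrableOn_domain_iff ht').2 fun s hs =>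
      ((hv.memLp hs ht' 2).mul' (hD.memLp_c ht hs) :
        MemLp (fun x => D.c t x * v x) 2 _).integrable_mul (hv.memLp hs ht' 2)
  calc μ * normSq (M.domain t) v
      = ∫ x in M.domain t, μ * v x ^ 2 := by rw [normSq_eq_integral_sq, integral_const_mul]
    _ ≤ ∫ x in M.domain t, (D.c t x * v x * v x - 1 / 2 * (divergence (D.b t) x * v x ^ 2)) := by
        refine integral_mono_ae (hsq.const_mul μ) (hreact.sub (hdiv.const_mul (1 / 2))) ?_
        filter_upwards [hcoer] with x hx
        nlinarith [mul_le_mul_of_nonneg_right hx (sq_nonneg (v x))]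
    _ = _ := by
        rw [integral_sub hreact (hdiv.const_mul (1 / 2)), integral_const_mul, hparts]
        ring

theorem stabilization_ge (hv : M.IsFE k t v) (hT : 0 < T) (hD : D.IsRegular M)
    (ht : t ∈ Ioc 0 T) (hs : s ∈ M.cells) (hc_inv : 0 < c_inv)
    (hinv : InverseInequality M k c_inv)
    (hδ₁ : D.δ s t * (2 * supNorm (M.cell s t) (D.c t) ^ 2) ≤ μ)
    (hδ₂ : D.δ s t ≤ M.cellDiam s t ^ 2 / (2 * D.ε * c_inv ^ 2)) :
    1 / 2 * (D.δ s t * normSq (M.cell s t) (convect M D t v))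
        - D.ε / 2 * normSq (M.cell s t) (gradient v) - μ / 2 * normSq (M.cell s t) v
      ≤ D.δ s t * ∫ x in M.cell s t,
          (-D.ε * Laplacian.laplacian v x + convect M D t v x + D.c t x * v x)
            * convect M D t v x := by
  have ht' : t ∈ Icc 0 T := Ioc_subset_Icc_self ht
  have hv2 := hv.memLp hs ht' 2
  have hc := hD.memLp_c ht hs
  have hδ := hD.δ_nonneg s hs t ht
  have hyoung := half_normSq_sub_normSq_le_integral
    (hv.memLp_convect hT hs ht' (hD.continuousOn_b ht') 2)
    ((hv.memLp_laplacian hs ht' 2).const_mul (-D.ε)) (hv2.mul' hc)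
  rw [normSq_const_mul, neg_sq] at hyoung
  have hdiffusion := hinv.mul_normSq_laplacian_le hc_inv hv ht hs hD.ε_pos hδ hδ₂
  have hreaction : D.δ s t * normSq (M.cell s t) (fun x => D.c t x * v x)
      ≤ μ / 2 * normSq (M.cell s t) v := by
    have := mul_le_mul_of_nonneg_left (normSq_mul_le hc hv2) hδ
    have := mul_le_mul_of_nonneg_right hδ₁ (normSq_nonneg (M.cell s t) v)
    linarith
  linarith [mul_le_mul_of_nonneg_left hyoung hδ]

theorem half_tripleNormSq_le_aSUPG (hv : M.IsFE k t v) (hT : 0 < T) (hD : D.IsRegular M)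
    (ht : t ∈ Ioc 0 T)
    (hcoer : ∀ᵐ x ∂volume.restrict (M.domain t), μ ≤ D.c t x - 1 / 2 * divergence (D.b t) x)
    (hc_inv : 0 < c_inv) (hinv : InverseInequality M k c_inv)
    (hδ₁ : ∀ s ∈ M.cells, D.δ s t * (2 * supNorm (M.cell s t) (D.c t) ^ 2) ≤ μ)
    (hδ₂ : ∀ s ∈ M.cells, D.δ s t ≤ M.cellDiam s t ^ 2 / (2 * D.ε * c_inv ^ 2)) :
    1 / 2 * tripleNormSq M D μ t v ≤ aSUPG M D t v v := by
  have ht' : t ∈ Icc 0 T := Ioc_subset_Icc_self ht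
  have hgrad : ∫ x in M.domain t, inner ℝ (gradient v x) (gradient v x)
      = normSq (M.domain t) (gradient v) := by
    simp only [real_inner_self_eq_norm_sq, normSq]
  have hstab := Finset.sum_le_sum fun s hs =>
    hv.stabilization_ge hT hD ht hs hc_inv hinv (hδ₁ s hs) (hδ₂ s hs)
  rw [Finset.sum_sub_distrib, Finset.sum_sub_distrib, ← Finset.mul_sum, ← Finset.mul_sum,
    ← Finset.mul_sum, ← normSq_domain ht' fun s hs => hv.memLp_gradient hs ht' 2,
    ← normSq_domain ht' fun s hs => hv.memLp hs ht' 2] at hstab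
  rw [tripleNormSq, aSUPG, hgrad]
  linarith [hv.mul_normSq_le_convection_add_reaction hD ht hcoer]

end MovingMesh.IsFE

/-- The right-hand side of the SUPG problem at time `t`, tested with `v`. -/
noncomputable def load (M : MovingMesh d T) (D : Data d) (t : ℝ) (v : Space d → ℝ) : ℝ :=
  (∫ x in M.domain t, D.f t x * v x)
    + ∑ s ∈ M.cells, D.δ s t * ∫ x in M.cell s t, D.f t x * convect M D t v x

theorem MovingMesh.IsFE.load_le (hv : M.IsFE k t v) (hT : 0 < T) (hD : D.IsRegular M)
    (ht : t ∈ Ioc 0 T) (hμ : 0 < μ) :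
    load M D t v ≤ 1 / μ * normSq (M.domain t) (D.f t)
      + (∑ s ∈ M.cells, D.δ s t * normSq (M.cell s t) (D.f t))
      + 1 / 4 * tripleNormSq M D μ t v := by
  have ht' : t ∈ Icc 0 T := Ioc_subset_Icc_self ht
  have hv2 : MemLp v 2 (volume.restrict (M.domain t)) :=
    memLp_of_continuousOn_of_isCompact (isCompact_domain ht') hv.continuousOn 2
  have hsource := integral_mul_le_of_memLp_two (hD.f_memLp t ht) hv2 (one_div_pos.2 hμ)
  have hstab (s : Finset (Space d)) (hs : s ∈ M.cells) :
      D.δ s t * ∫ x in M.cell s t, D.f t x * convect M D t v x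
        ≤ D.δ s t * normSq (M.cell s t) (D.f t)
          + 1 / 4 * (D.δ s t * normSq (M.cell s t) (convect M D t v)) := by
    have := mul_le_mul_of_nonneg_left (integral_mul_le_of_memLp_two (hD.memLp_f ht hs)
      (hv.memLp_convect hT hs ht' (hD.continuousOn_b ht') 2) one_pos) (hD.δ_nonneg s hs t ht)
    simp only [normSq_eq_integral_sq]
    linarith
  have hsum := Finset.sum_le_sum hstab
  rw [Finset.sum_add_distrib, ← Finset.mul_sum] at hsum
  have hgrad := mul_nonneg hD.ε_pos.le (normSq_nonneg (M.domain t) (gradient v))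
  have hr : (4 * (1 / μ))⁻¹ = μ / 4 := by field_simp
  rw [hr, ← normSq_eq_integral_sq, ← normSq_eq_integral_sq] at hsource
  rw [load, tripleNormSq]
  linarith

theorem MovingMesh.IsFE.two_mul_integral_aleDeriv_sub_le (hv : M.IsFE k t (u t)) (hT : 0 < T)
    (hD : D.IsRegular M) (ht : t ∈ Ioc 0 T) (hμ : 0 < μ)
    (hcoer : ∀ᵐ x ∂volume.restrict (M.domain t), μ ≤ D.c t x - 1 / 2 * divergence (D.b t) x)
    (hc_inv : 0 < c_inv) (hinv : InverseInequality M k c_inv)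
    (hδ₁ : ∀ s ∈ M.cells, D.δ s t * (2 * supNorm (M.cell s t) (D.c t) ^ 2) ≤ μ)
    (hδ₂ : ∀ s ∈ M.cells, D.δ s t ≤ M.cellDiam s t ^ 2 / (2 * D.ε * c_inv ^ 2))
    (heq : (∫ x in M.domain t, M.aleDeriv u t x * u t x) + aSUPG M D t (u t) (u t)
        - (∫ x in M.domain t, inner ℝ (M.velocity t x) (gradient (u t) x) * u t x)
      = load M D t (u t)) :
    2 * (∫ x in M.domain t, M.aleDeriv u t x * u t x)
        - 2 * (∫ x in M.domain t, inner ℝ (M.velocity t x) (gradient (u t) x) * u t x)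
      ≤ 2 / μ * normSq (M.domain t) (D.f t)
        + 2 * (∑ s ∈ M.cells, D.δ s t * normSq (M.cell s t) (D.f t))
        - 1 / 2 * tripleNormSq M D μ t (u t) := by
  have hcoercive := hv.half_tripleNormSq_le_aSUPG hT hD ht hcoer hc_inv hinv hδ₁ hδ₂
  have hload := hv.load_le hT hD ht hμ
  have htwo : 2 / μ * normSq (M.domain t) (D.f t) = 2 * (1 / μ * normSq (M.domain t) (D.f t)) := by
    ring
  linarith

end

/-! ### Integrability in time -/

section

variable {d : ℕ} {T : ℝ} {M : MovingMesh d T} {s : Finset (Space d)} {k : ℕ} {D : Data d}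
  {c_inv : ℝ} {u : ℝ → Space d → ℝ}

namespace MovingMesh

/-- The part of space-time swept by the moving cell with reference vertices `s`. -/
def cellTrace (M : MovingMesh d T) (s : Finset (Space d)) : Set (ℝ × Space d) :=
  {p | p.1 ∈ Icc 0 T ∧ p.2 ∈ M.cell s p.1}

theorem isCompact_cellTrace (hs : s ∈ M.cells) : IsCompact (M.cellTrace s) := by
  obtain ⟨C⟩ := nonempty_cellChart hs
  have himage : M.cellTrace s
      = (fun p : ℝ × Space d => (p.1, C.map p.1 p.2)) '' (Icc 0 T ×ˢ refCell s) := by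
    ext ⟨t, x⟩
    constructor
    · rintro ⟨ht, hx⟩
      obtain ⟨Y, hY, hYx⟩ := C.cell_eq_image ht ▸ hx
      exact ⟨(t, Y), ⟨ht, hY⟩, Prod.ext rfl hYx⟩
    · rintro ⟨⟨τ, Y⟩, ⟨ht, hY⟩, h⟩
      obtain ⟨rfl, rfl⟩ := Prod.mk.inj h
      exact ⟨ht, C.cell_eq_image ht ▸ mem_image_of_mem _ hY⟩
  rw [himage]
  exact (isCompact_Icc.prod (isCompact_refCell s)).image_of_continuousOn
    (continuousOn_fst.prodMk (C.continuousOn_map.mono (prod_mono_right (subset_univ _))))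

theorem exists_cellDiam_le (hs : s ∈ M.cells) : ∃ R, ∀ t ∈ Icc 0 T, M.cellDiam s t ≤ R :=
  ⟨Metric.diam (Prod.snd '' M.cellTrace s), fun t ht => Metric.diam_mono
    (fun x hx => ⟨(t, x), ⟨ht, hx⟩, rfl⟩)
    ((isCompact_cellTrace hs).image continuous_snd).isBounded⟩

theorem integrableOn_normSq_cell (hs : s ∈ M.cells) {f : ℝ → Space d → ℝ}
    (hf : MemLp (fun p : ℝ × Space d => f p.1 p.2) 2 (volume.restrict M.spaceTime)) :
    IntegrableOn (fun t => normSq (M.cell s t) (f t)) (Ioc 0 T) := by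
  have hsub : M.cellTrace s ⊆ M.spaceTime := fun p hp => ⟨hp.1, cell_subset_domain hs _ hp.2⟩
  have hsq : IntegrableOn (fun p : ℝ × Space d => f p.1 p.2 ^ 2) (M.cellTrace s) :=
    (hf.mono_measure (Measure.restrict_mono_set _ hsub)).integrable_sq
  rw [← integrable_indicator_iff (isCompact_cellTrace hs).measurableSet,
    Measure.volume_eq_prod] at hsq
  refine hsq.integral_prod_left.integrableOn.congr ?_
  filter_upwards [ae_restrict_mem measurableSet_Ioc] with t ht
  have ht' : t ∈ Icc 0 T := Ioc_subset_Icc_self ht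
  rw [normSq_eq_integral_sq, ← integral_indicator (isCompact_cell hs ht').measurableSet]
  exact integral_congr_ae (.of_forall fun x => indicator_eq_indicator (and_iff_right ht') rfl)

end MovingMesh

open MovingMesh

namespace Data.IsRegular

theorem integrableOn_normSq_f (hD : D.IsRegular M) :
    IntegrableOn (fun t => normSq (M.domain t) (D.f t)) (Ioc 0 T) := by
  refine IntegrableOn.congr_fun
    (integrable_finsetSum M.cells fun s hs => integrableOn_normSq_cell hs hD.f_memLp_spaceTime)
    (fun t ht => ?_) measurableSet_Ioc
  exact (normSq_domain (Ioc_subset_Icc_self ht) fun s hs => hD.memLp_f ht hs).symm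

theorem integrableOn_sum_δ_mul (hD : D.IsRegular M)
    (hδ₂ : ∀ t ∈ Ioc 0 T, ∀ s ∈ M.cells, D.δ s t ≤ M.cellDiam s t ^ 2 / (2 * D.ε * c_inv ^ 2))
    {g : Finset (Space d) → ℝ → ℝ} (hg : ∀ s ∈ M.cells, IntegrableOn (g s) (Ioc 0 T)) :
    IntegrableOn (fun t => ∑ s ∈ M.cells, D.δ s t * g s t) (Ioc 0 T) := by
  refine integrable_finsetSum _ fun s hs => ?_
  obtain ⟨R, hdiam⟩ := exists_cellDiam_le hs
  refine (hg s hs).bdd_mul (c := R ^ 2 / (2 * D.ε * c_inv ^ 2))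
    (hD.δ_measurable s hs).aestronglyMeasurable ?_
  filter_upwards [ae_restrict_mem measurableSet_Ioc] with t ht
  rw [Real.norm_of_nonneg (hD.δ_nonneg s hs t ht)]
  refine (hδ₂ t ht s hs).trans ?_
  have hε := hD.ε_pos
  have hdiam_nonneg : 0 ≤ M.cellDiam s t := Metric.diam_nonneg
  gcongr
  exact hdiam t (Ioc_subset_Icc_self ht)

end Data.IsRegular

theorem MovingMesh.IsMovingFE.integrableOn_tripleNormSq (hu : M.IsMovingFE k u) (hT : 0 < T)
    (hD : D.IsRegular M)
    (hδ₂ : ∀ t ∈ Ioc 0 T, ∀ s ∈ M.cells, D.δ s t ≤ M.cellDiam s t ^ 2 / (2 * D.ε * c_inv ^ 2))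
    (μ : ℝ) : IntegrableOn (fun t => tripleNormSq M D μ t (u t)) (Ioc 0 T) := by
  have hcont {g : ℝ → ℝ} (hg : ContinuousOn g (Icc 0 T)) : IntegrableOn g (Ioc 0 T) :=
    hg.integrableOn_Icc.mono_set Ioc_subset_Icc_self
  refine (((hcont hu.continuousOn_normSq_gradient_domain).const_mul _).add
    (hD.integrableOn_sum_δ_mul hδ₂ fun s hs => hcont ?_)).add
    ((hcont hu.continuousOn_normSq_domain).const_mul _)
  exact hu.continuousOn_normSq_convect_cell hT hs hD.b_continuousOn

end

theorem mainTheorem4_general {d : ℕ} {T : ℝ} (hT : 0 < T) {M : MovingMesh d T} {k : ℕ}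
    {D : Data d} (hD : D.IsRegular M) {μ : ℝ} (hμ : 0 < μ)
    (hcoer : ∀ t ∈ Ioc 0 T, ∀ᵐ x ∂volume.restrict (M.domain t),
      μ ≤ D.c t x - 1 / 2 * divergence (D.b t) x)
    {c_inv : ℝ} (hc_inv : 0 < c_inv) (hinv : InverseInequality M k c_inv)
    (hδ₁ : ∀ t ∈ Ioc 0 T, ∀ s ∈ M.cells,
      D.δ s t * (2 * supNorm (M.cell s t) (D.c t) ^ 2) ≤ μ)
    (hδ₂ : ∀ t ∈ Ioc 0 T, ∀ s ∈ M.cells,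
      D.δ s t ≤ M.cellDiam s t ^ 2 / (2 * D.ε * c_inv ^ 2))
    {u : ℝ → Space d → ℝ} (hu : M.IsMovingFE k u)
    (henergy : ∀ t ∈ Ioc 0 T, (∫ x in M.domain t, M.aleDeriv u t x * u t x)
        + aSUPG M D t (u t) (u t)
        - (∫ x in M.domain t, inner ℝ (M.velocity t x) (gradient (u t) x) * u t x)
      = load M D t (u t)) :
    IntervalIntegrable (fun t => tripleNormSq M D μ t (u t)) volume 0 T ∧
    ∀ τ ∈ Icc 0 T,
      normSq (M.domain τ) (u τ) + 1 / 2 * ∫ t in (0 : ℝ)..τ, tripleNormSq M D μ t (u t)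
        ≤ normSq (M.domain 0) (u 0)
          + 2 / μ * (∫ t in (0 : ℝ)..τ, normSq (M.domain t) (D.f t))
          + 2 * ∫ t in (0 : ℝ)..τ, ∑ s ∈ M.cells, D.δ s t * normSq (M.cell s t) (D.f t) := by
  have htriple := hu.integrableOn_tripleNormSq hT hD hδ₂ μ
  refine ⟨(intervalIntegrable_iff_integrableOn_Ioc_of_le hT.le).2 htriple, fun τ hτ => ?_⟩
  have hinterval {g : ℝ → ℝ} (hg : IntegrableOn g (Ioc 0 T)) : IntervalIntegrable g volume 0 τ :=
    (intervalIntegrable_iff_integrableOn_Ioc_of_le hτ.1).2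
      (hg.mono_set (Ioc_subset_Ioc_right hτ.2))
  have hf := hinterval hD.integrableOn_normSq_f
  have hδf := hinterval (hD.integrableOn_sum_δ_mul hδ₂ fun s hs =>
    M.integrableOn_normSq_cell hs hD.f_memLp_spaceTime)
  have hdata : IntervalIntegrable (fun t => 2 / μ * normSq (M.domain t) (D.f t)
      + 2 * ∑ s ∈ M.cells, D.δ s t * normSq (M.cell s t) (D.f t)) volume 0 τ :=
    (hf.const_mul _).add (hδf.const_mul _)
  have hbound := le_add_integral_of_hasDerivWithinAt_le hu.continuousOn_normSq_domain
    (fun t ht => hu.hasDerivWithinAt_normSq_domain hT ht)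
    (hdata.sub ((hinterval htriple).const_mul (1 / 2)))
    (fun t ht => (hu.isFE t (Ioc_subset_Icc_self ht)).two_mul_integral_aleDeriv_sub_le hT hD ht hμ
      (hcoer t ht) hc_inv hinv (hδ₁ t ht) (hδ₂ t ht) (henergy t ht)) hτ
  rw [intervalIntegral.integral_sub hdata ((hinterval htriple).const_mul _),
    intervalIntegral.integral_add (hf.const_mul _) (hδf.const_mul _)] at hbound
  simp only [intervalIntegral.integral_const_mul] at hbound
  linarith

end ALESUPG

open ALESUPG in
theorem mainTheorem4 {d : ℕ} (hd : d = 2 ∨ d = 3) {T : ℝ} (hT : 0 < T)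
    (M : MovingMesh d T) (k : ℕ) (D : Data d) (hD : D.IsRegular M)
    (μ : ℝ) (hμ : 0 < μ)
    (hcoer : ∀ t ∈ Ioc 0 T, ∀ᵐ x ∂(volume.restrict (M.domain t)),
      μ ≤ D.c t x - 1 / 2 * divergence (D.b t) x)
    (c_inv : ℝ) (hc_inv : 0 < c_inv) (hinv : InverseInequality M k c_inv)
    (hδ₁ : ∀ t ∈ Ioc 0 T, ∀ s ∈ M.cells,
      D.δ s t * (2 * supNorm (M.cell s t) (D.c t) ^ 2) ≤ μ)
    (hδ₂ : ∀ t ∈ Ioc 0 T, ∀ s ∈ M.cells,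
      D.δ s t ≤ M.cellDiam s t ^ 2 / (2 * D.ε * c_inv ^ 2))
    (u₀ : Space d → ℝ) (hu₀ : MemLp u₀ 2 (volume.restrict (M.domain 0)))
    (u : ℝ → Space d → ℝ) (hu : IsSemidiscreteSolution M k D u₀ u) :
    IntervalIntegrable (fun t => tripleNormSq M D μ t (u t)) volume 0 T ∧
    ∀ τ ∈ Icc 0 T,
      normSq (M.domain τ) (u τ) + 1 / 2 * ∫ t in (0 : ℝ)..τ, tripleNormSq M D μ t (u t)
        ≤ normSq (M.domain 0) (u 0)
          + 2 / μ * (∫ t in (0 : ℝ)..τ, normSq (M.domain t) (D.f t))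
          + 2 * ∫ t in (0 : ℝ)..τ, ∑ s ∈ M.cells, D.δ s t * normSq (M.cell s t) (D.f t) :=
  mainTheorem4_general hT hD hμ hcoer hc_inv hinv hδ₁ hδ₂
    ⟨hu.isFE, hu.continuousOn, hu.differentiableOn⟩
    fun t ht => hu.equation t ht _ (hu.isFE t (Ioc_subset_Icc_self ht))
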